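/- Let $\mathit{Frm}_\sim$ be the set of formulas built from a countably infinite set of propositional variables with $\bot,\top,\land,\lor,\to$ and a unary operator $\boxtimes$, and let $\mathit{Frm}_{\mathit{clm}}$ be the set of formulas built from the same variables with $\bot,\top,\land,\neg,\square$; in the latter, $\lor$ and $\to$ are the usual abbreviations and $\square^+\varphi:=\varphi\land\square\varphi$. For $\heartsuit\in\{\sim,\mathit{clm}\}$, a $\heartsuit$-rule $\Gamma/\Delta$ is a pair of finite sets of $\heartsuit$-formulas. A $\heartsuit$-rule system is a set $S$ of $\heartsuit$-rules such that, for all finite sets $\Gamma,\Gamma',\Delta,\Delta'$ of formulas and all formulas $\varphi,\psi$: - if $\Gamma/\Delta\in S$, then $s[\Gamma]/s[\Delta]\in S$ for every substitution $s$; - $\varphi/\varphi\in S$; - if $\Gamma/\Delta\in S$, then $\Gamma\cup\Gamma'/\Delta\cup\Delta'\in S$; - if $\Gamma/\Delta\cup\{\varphi\}\in S$ and $\Gamma\cup\{\varphi\}/\Delta\in S$, then $\Gamma/\Delta\in S$; - $\varphi,\varphi\to\psi/\psi\in S$; - $\varphi/\odot\varphi\in S$, where $\odot=\boxtimes$ if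 $\heartsuit={\sim}$, and $\odot=\square$ if $\heartsuit=\mathit{clm}$. Ordered by inclusion, the $\heartsuit$-rule systems form a complete lattice; write $S\oplus\Sigma$ for the least $\heartsuit$-rule system containing $S\cup\Sigma$. For a $\heartsuit$-rule system $S$, let $\mathbf{NExt}(S)$ be the complete lattice of all $\heartsuit$-rule systems that contain $S$, ordered by inclusion. Let $p,q$ be two distinct variables. - $\mathsf{mHC}$ (the modalized Heyting calculus) is the least $\sim$-rule system containing $/\varphi$ for every theorem $\varphi$ of the intuitionistic propositional calculus, and the rules $/\boxtimes(p\to q)\to(\boxtimes p\to\boxtimes q)$, $\;/p\to\boxtimes p$ and $/\boxtimes p\to(q\lor(q\to p))$. - $\mathsf{K4}$ is the least $\mathit{clm}$-rule system containing $/\varphi$ for every $\varphi$ valid in all transitive Kripke frames, and $\mathsf{K4.Grz}:=\mathsf{K4}\oplus\{/\square(\square(p\to\square p)\to p)\to\square p\}$. Define $T:\mathit{Frm}_\sim\to\mathit{Frm}_{\mathit{clm}}$ by $T(r)=\square^+r$ for every variable $r$, $T(\bot)=\bot$, $T(\top)=\top$, $T(\varphi\land\psi)=T(\varphi)\land T(\psi)$,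 $T(\varphi\lor\psi)=T(\varphi)\lor T(\psi)$, $T(\varphi\to\psi)=\square^+(\neg T(\varphi)\lor T(\psi))$, $T(\boxtimes\varphi)=\square T(\varphi)$, and put $T(\Gamma/\Delta):=T[\Gamma]/T[\Delta]$. For $L\in\mathbf{NExt}(\mathsf{mHC})$ and $M\in\mathbf{NExt}(\mathsf{K4})$ let $$\tau L:=\mathsf{K4}\oplus\{T(\Gamma/\Delta):\Gamma/\Delta\in L\},\qquad \sigma L:=\mathsf{K4.Grz}\oplus\tau L,\qquad \rho M:=\{\Gamma/\Delta : T(\Gamma/\Delta)\in M\}.$$ **Theorem (Esakia theorem for $\sim$-rule systems).** The map $\sigma$ and the restriction of $\rho$ to $\mathbf{NExt}(\mathsf{K4.Grz})$ are mutually inverse complete lattice isomorphisms between $\mathbf{NExt}(\mathsf{mHC})$ and $\mathbf{NExt}(\mathsf{K4.Grz})$. (In particular, $\rho M$ is a rule system in $\mathbf{NExt}(\mathsf{mHC})$ for every $M\in\mathbf{NExt}(\mathsf{K4.Grz})$.) -/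

import Mathlib

namespace EsakiaThm

/-! ## Formulas -/

/-- Superintuitionistic modal formulas (`box` is the operator `⊠`); the propositional variables
are `var 0, var 1, …`. -/
inductive SimFrm : Type where
  | var : ℕ → SimFrm
  | bot : SimFrm
  | top : SimFrm
  | and : SimFrm → SimFrm → SimFrm
  | or : SimFrm → SimFrm → SimFrm
  | imp : SimFrm → SimFrm → SimFrm
  | box : SimFrm → SimFrm
  deriving DecidableEq

/-- Classical modal formulas. -/
inductive ClmFrm : Type where
  | var : ℕ → ClmFrm
  | bot : ClmFrm
  | top : ClmFrm
  | and : ClmFrm → ClmFrm → ClmFrm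
  | neg : ClmFrm → ClmFrm
  | box : ClmFrm → ClmFrm
  deriving DecidableEq

/-- The extension of a map on variables to a substitution commuting with all connectives. -/
def SimFrm.subst (s : ℕ → SimFrm) : SimFrm → SimFrm
  | .var n => s n
  | .bot => .bot
  | .top => .top
  | .and a b => .and (a.subst s) (b.subst s)
  | .or a b => .or (a.subst s) (b.subst s)
  | .imp a b => .imp (a.subst s) (b.subst s)
  | .box a => .box (a.subst s)

/-- The extension of a map on variables to a substitution commuting with all connectives. -/
def ClmFrm.subst (s : ℕ → ClmFrm) : ClmFrm → ClmFrm
  | .var n => s n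
  | .bot => .bot
  | .top => .top
  | .and a b => .and (a.subst s) (b.subst s)
  | .neg a => .neg (a.subst s)
  | .box a => .box (a.subst s)

/-- The abbreviation `a ∨ b := ¬(¬a ∧ ¬b)`. -/
def ClmFrm.or (a b : ClmFrm) : ClmFrm := .neg (.and (.neg a) (.neg b))

/-- The abbreviation `a → b := ¬(a ∧ ¬b)`. -/
def ClmFrm.imp (a b : ClmFrm) : ClmFrm := .neg (.and a (.neg b))

/-- The abbreviation `□⁺a := a ∧ □a`. -/
def ClmFrm.boxPlus (a : ClmFrm) : ClmFrm := .and a (.box a)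

/-! ## Rule systems -/

/-- What the definition of a rule system needs to know about a set of formulas. It is used only
for the two instances below. -/
class ModalFrm (F : Type) where
  imp : F → F → F
  box : F → F
  subst : (ℕ → F) → F → F

instance : ModalFrm SimFrm := ⟨SimFrm.imp, SimFrm.box, SimFrm.subst⟩

instance : ModalFrm ClmFrm := ⟨ClmFrm.imp, ClmFrm.box, ClmFrm.subst⟩

/-- A rule `Γ/Δ` is a pair of finite sets of formulas. -/
abbrev Rule (F : Type) : Type := Finset F × Finset F

/-- The rule `/φ`, without assumptions and with the single conclusion `φ`. -/
def Rule.fact {F : Type} (φ : F) : Rule F := (∅, {φ})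

/-- The rule `f[Γ]/f[Δ]`. -/
def Rule.map {F G : Type} [DecidableEq G] (f : F → G) (r : Rule F) : Rule G :=
  (r.1.image f, r.2.image f)

/-- Rule systems over `F`. -/
@[ext]
structure RuleSystem (F : Type) [DecidableEq F] [ModalFrm F] : Type where
  rules : Set (Rule F)
  structurality : ∀ r ∈ rules, ∀ s : ℕ → F, Rule.map (ModalFrm.subst s) r ∈ rules
  reflexivity : ∀ φ : F, (({φ}, {φ}) : Rule F) ∈ rules
  monotonicity : ∀ Γ Δ Γ' Δ' : Finset F,
    ((Γ, Δ) : Rule F) ∈ rules → ((Γ ∪ Γ', Δ ∪ Δ') : Rule F) ∈ rules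
  cut : ∀ (Γ Δ : Finset F) (φ : F),
    ((Γ, insert φ Δ) : Rule F) ∈ rules → ((insert φ Γ, Δ) : Rule F) ∈ rules →
      ((Γ, Δ) : Rule F) ∈ rules
  modusPonens : ∀ φ ψ : F, (({φ, ModalFrm.imp φ ψ}, {ψ}) : Rule F) ∈ rules
  necessitation : ∀ φ : F, (({φ}, {ModalFrm.box φ}) : Rule F) ∈ rules

section

variable {F : Type} [DecidableEq F] [ModalFrm F]

/-- Rule systems are ordered by inclusion. -/
instance : PartialOrder (RuleSystem F) :=
  PartialOrder.lift RuleSystem.rules fun _ _ h => RuleSystem.ext h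

/-- The infimum of a set of rule systems is its intersection. -/
instance : InfSet (RuleSystem F) where
  sInf A :=
    { rules := {r | ∀ S ∈ A, r ∈ S.rules}
      structurality := fun r hr s S hS => S.structurality r (hr S hS) s
      reflexivity := fun φ S _ => S.reflexivity φ
      monotonicity := fun Γ Δ Γ' Δ' h S hS => S.monotonicity Γ Δ Γ' Δ' (h S hS)
      cut := fun Γ Δ φ h h' S hS => S.cut Γ Δ φ (h S hS) (h' S hS)
      modusPonens := fun φ ψ S _ => S.modusPonens φ ψ
      necessitation := fun φ S _ => S.necessitation φ }

/-- The complete lattice of all rule systems, ordered by inclusion. -/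
instance : CompleteLattice (RuleSystem F) :=
  completeLatticeOfInf (RuleSystem F) fun _ =>
    ⟨fun S hS _ hr => hr S hS, fun _ hS _ hr _ hT => hS hT hr⟩

/-- The least rule system that contains all rules of `X`. -/
def RuleSystem.generate (X : Set (Rule F)) : RuleSystem F := sInf {S | X ⊆ S.rules}

/-- The set of all rule systems that extend `S`, ordered by inclusion. -/
def NExt (S : RuleSystem F) : Type := {S' : RuleSystem F // S ≤ S'}

instance (S : RuleSystem F) : PartialOrder (NExt S) :=
  inferInstanceAs (PartialOrder {S' : RuleSystem F // S ≤ S'})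

instance (S : RuleSystem F) : InfSet (NExt S) where
  sInf A := ⟨sInf (Subtype.val '' A), le_sInf (by rintro _ ⟨T, _, rfl⟩; exact T.2)⟩

/-- The complete lattice of all rule systems that extend `S`, ordered by inclusion. -/
instance (S : RuleSystem F) : CompleteLattice (NExt S) :=
  completeLatticeOfInf (NExt S) fun _ =>
    ⟨fun T hT => sInf_le (a := T.1) ⟨T, hT, rfl⟩,
      fun T hT => le_sInf (a := T.1) (by rintro _ ⟨U, hU, rfl⟩; exact hT hU)⟩

end

/-! ## The modalized Heyting calculus -/

/-- Formulas of the intuitionistic propositional calculus. -/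
inductive IntFrm : Type where
  | var : ℕ → IntFrm
  | bot : IntFrm
  | top : IntFrm
  | and : IntFrm → IntFrm → IntFrm
  | or : IntFrm → IntFrm → IntFrm
  | imp : IntFrm → IntFrm → IntFrm

/-- Theorems of the intuitionistic propositional calculus (Hilbert-style). -/
inductive IntFrm.Provable : IntFrm → Prop where
  | k (a b : IntFrm) : Provable (a.imp (b.imp a))
  | s (a b c : IntFrm) : Provable ((a.imp (b.imp c)).imp ((a.imp b).imp (a.imp c)))
  | andLeft (a b : IntFrm) : Provable ((a.and b).imp a)
  | andRight (a b : IntFrm) : Provable ((a.and b).imp b)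
  | andIntro (a b : IntFrm) : Provable (a.imp (b.imp (a.and b)))
  | orLeft (a b : IntFrm) : Provable (a.imp (a.or b))
  | orRight (a b : IntFrm) : Provable (b.imp (a.or b))
  | orElim (a b c : IntFrm) : Provable ((a.imp c).imp ((b.imp c).imp ((a.or b).imp c)))
  | botElim (a : IntFrm) : Provable (IntFrm.bot.imp a)
  | topIntro : Provable IntFrm.top
  | mp (a b : IntFrm) : Provable (a.imp b) → Provable a → Provable b

/-- Intuitionistic formulas as superintuitionistic modal formulas. -/
def IntFrm.toSim : IntFrm → SimFrm
  | .var n => .var n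
  | .bot => .bot
  | .top => .top
  | .and a b => .and a.toSim b.toSim
  | .or a b => .or a.toSim b.toSim
  | .imp a b => .imp a.toSim b.toSim

/-- The modalized Heyting calculus: the least rule system containing `/φ` for every theorem `φ`
of the intuitionistic propositional calculus, and, for two variables `p`, `q`,
`/⊠(p → q) → (⊠p → ⊠q)`, `/p → ⊠p` and `/⊠p → (q ∨ (q → p))`. -/
def mHC : RuleSystem SimFrm :=
  let p : SimFrm := .var 0
  let q : SimFrm := .var 1
  RuleSystem.generate
    ({r | ∃ φ : IntFrm, φ.Provable ∧ r = Rule.fact φ.toSim} ∪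
      {Rule.fact (.imp (.box (.imp p q)) (.imp (.box p) (.box q))),
       Rule.fact (.imp p (.box p)),
       Rule.fact (.imp (.box p) (.or q (.imp q p)))})

/-! ## K4 and K4.Grz -/

/-- Truth of a formula at a point of the Kripke frame `(W, R)` under the valuation `V`. -/
def ClmFrm.Sat {W : Type} (R : W → W → Prop) (V : ℕ → Set W) : W → ClmFrm → Prop
  | w, .var n => w ∈ V n
  | _, .bot => False
  | _, .top => True
  | w, .and a b => ClmFrm.Sat R V w a ∧ ClmFrm.Sat R V w b
  | w, .neg a => ¬ ClmFrm.Sat R V w a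
  | w, .box a => ∀ v, R w v → ClmFrm.Sat R V v a

/-- Validity in all transitive Kripke frames. -/
def ClmFrm.TransitiveValid (φ : ClmFrm) : Prop :=
  ∀ (W : Type) (R : W → W → Prop), (∀ x y z, R x y → R y z → R x z) →
    ∀ (V : ℕ → Set W) (w : W), ClmFrm.Sat R V w φ

/-- `K4`: the least rule system containing `/φ` for every `φ` valid in all transitive Kripke
frames. -/
def K4 : RuleSystem ClmFrm :=
  RuleSystem.generate {r | ∃ φ : ClmFrm, φ.TransitiveValid ∧ r = Rule.fact φ}

/-- `K4.Grz`: the extension of `K4` by the rule `/□(□(p → □p) → p) → □p`. -/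
def K4Grz : RuleSystem ClmFrm :=
  let p : ClmFrm := .var 0
  K4 ⊔ RuleSystem.generate
    {Rule.fact (.imp (.box (.imp (.box (.imp p (.box p))) p)) (.box p))}

/-! ## The translation and the maps between rule systems -/

/-- The translation `T` of superintuitionistic modal formulas into classical modal formulas. -/
def transl : SimFrm → ClmFrm
  | .var n => .boxPlus (.var n)
  | .bot => .bot
  | .top => .top
  | .and a b => .and (transl a) (transl b)
  | .or a b => .or (transl a) (transl b)
  | .imp a b => .boxPlus (.or (.neg (transl a)) (transl b))
  | .box a => .box (transl a)

/-- `τL = K4 ⊕ {T(Γ/Δ) : Γ/Δ ∈ L}`. -/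
def tau (L : RuleSystem SimFrm) : RuleSystem ClmFrm :=
  K4 ⊔ RuleSystem.generate (Rule.map transl '' L.rules)

/-- `σL = K4.Grz ⊕ τL`. -/
def sigma (L : RuleSystem SimFrm) : RuleSystem ClmFrm := K4Grz ⊔ tau L

/-- The set of rules `ρM = {Γ/Δ : T(Γ/Δ) ∈ M}`. -/
def rho (M : RuleSystem ClmFrm) : Set (Rule SimFrm) := {r | Rule.map transl r ∈ M.rules}

end EsakiaThm

namespace EsakiaThm

/-! ## Derived closure properties of rule systems -/

section

variable {F : Type} [DecidableEq F] [ModalFrm F] (S : RuleSystem F)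

/-! Everything reduces to ρσL = L and σρM = M: then σ is an order isomorphism with inverse ρ, and
order isomorphisms preserve all joins and meets.

The inclusion ρσL ⊆ L is a completeness argument (`rho_sigma`). A rule outside L is refuted by a
saturated set G (`exists_isSaturated`). The prime theories over G form a transitive frame; by ⊠p →
(q ∨ (q → p)), the reflexive closure of its relation is inclusion. The Boolean closure of the
extents of formulas is closed under □, and it satisfies Grz because membership in a Boolean
combination of upsets changes only finitely often along a chain. The interior of each of its members
is again an extent, so a valuation in it reads a translated rule as a substitution instance of the
original one. Hence this general frame validates σL and refutes the translated rule.

For σρM = M it is enough that M is determined by ρM (`le_of_rho_subset`). Fix a finite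
subformula-closed Θ and a transitive model of finitely many instances of Grz. Each point is
relabelled by a Θ-type that depends only on the truth of finitely many open formulas □⁺f. Grz
supplies, above any point that sees a type, a final point of that type, where label and type
coincide. So the new labels satisfy a truth lemma, and they are exactly the types realised in the
model (`exists_relabelling`). The new valuation consists of Boolean combinations of open formulas,
so □⁺ of the substituted formula is a translation (`exists_transl_equiv`). One substitution thus
turns a rule into a translated rule, and a second one, modulo Grz, turns it back. -/

theorem RuleSystem.mono {Γ Δ Γ' Δ' : Finset F} (h : ((Γ, Δ) : Rule F) ∈ S.rules)
    (hΓ : Γ ⊆ Γ') (hΔ : Δ ⊆ Δ') : ((Γ', Δ') : Rule F) ∈ S.rules := by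
  have := S.monotonicity Γ Δ Γ' Δ' h
  rwa [Finset.union_eq_right.2 hΓ, Finset.union_eq_right.2 hΔ] at this

theorem RuleSystem.mem_of_mem {Γ Δ : Finset F} {φ : F} (h : φ ∈ Γ) (h' : φ ∈ Δ) :
    ((Γ, Δ) : Rule F) ∈ S.rules :=
  S.mono (S.reflexivity φ) (by simpa) (by simpa)

/-- Simultaneous cut on all assumptions and all conclusions of a rule. -/
theorem RuleSystem.cutAll {Γ Δ Γ' Δ' : Finset F} (h : ((Γ, Δ) : Rule F) ∈ S.rules)
    (hl : ∀ γ ∈ Γ, ((Γ', insert γ Δ') : Rule F) ∈ S.rules)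
    (hr : ∀ δ ∈ Δ, ((insert δ Γ', Δ') : Rule F) ∈ S.rules) :
    ((Γ', Δ') : Rule F) ∈ S.rules := by
  have left : ∀ A : Finset F, (∀ γ ∈ A, ((Γ', insert γ Δ') : Rule F) ∈ S.rules) →
      ∀ E, Δ' ⊆ E → ((Γ' ∪ A, E) : Rule F) ∈ S.rules → ((Γ', E) : Rule F) ∈ S.rules := by
    intro A
    induction A using Finset.induction with
    | empty => intro _ E _ h; simpa using h
    | insert a A _ ih =>
      intro hA E hE h
      refine ih (fun γ hγ => hA γ (Finset.mem_insert_of_mem hγ)) E hE ?_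
      refine S.cut _ _ a ?_ (by simpa using h)
      exact S.mono (hA a (Finset.mem_insert_self _ _)) Finset.subset_union_left
        (Finset.insert_subset_insert _ hE)
  have right : ∀ A : Finset F, (∀ δ ∈ A, ((insert δ Γ', Δ') : Rule F) ∈ S.rules) →
      ((Γ', Δ' ∪ A) : Rule F) ∈ S.rules → ((Γ', Δ') : Rule F) ∈ S.rules := by
    intro A
    induction A using Finset.induction with
    | empty => intro _ h; simpa using h
    | insert a A _ ih =>
      intro hA h
      refine ih (fun γ hγ => hA γ (Finset.mem_insert_of_mem hγ)) ?_
      refine S.cut _ _ a (by simpa using h) ?_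
      exact S.mono (hA a (Finset.mem_insert_self _ _)) subset_rfl Finset.subset_union_left
  exact right Δ hr (left Γ hl _ Finset.subset_union_left
    (S.mono h Finset.subset_union_right Finset.subset_union_right))

theorem RuleSystem.cut_single {Γ Δ : Finset F} {φ : F} (h : ((Δ, {φ}) : Rule F) ∈ S.rules)
    (hl : ∀ γ ∈ Δ, ((Γ, {γ}) : Rule F) ∈ S.rules) : ((Γ, {φ}) : Rule F) ∈ S.rules :=
  S.cutAll h (fun γ hγ => S.mono (hl γ hγ) subset_rfl (by simp))
    (fun δ hδ => S.mem_of_mem (Finset.mem_insert_self _ _) (by simpa using hδ))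

/-- Replacing the formulas of a rule by interderivable ones. -/
theorem RuleSystem.replace {r r' : Rule F} (h : r ∈ S.rules)
    (hl : ∀ γ ∈ r.1, ((r'.1, {γ}) : Rule F) ∈ S.rules)
    (hr : ∀ δ ∈ r.2, ∃ δ' ∈ r'.2, ((insert δ r'.1, {δ'}) : Rule F) ∈ S.rules) :
    r' ∈ S.rules := by
  refine S.cutAll (Γ := r.1) (Δ := r.2) h (fun γ hγ => S.mono (hl γ hγ) subset_rfl (by simp)) ?_
  intro δ hδ
  obtain ⟨δ', h1, h2⟩ := hr δ hδ
  exact S.mono h2 subset_rfl (by simpa)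

theorem RuleSystem.mp {Γ : Finset F} {φ ψ : F} (h : ((Γ, {φ}) : Rule F) ∈ S.rules)
    (h' : ((Γ, {ModalFrm.imp φ ψ}) : Rule F) ∈ S.rules) : ((Γ, {ψ}) : Rule F) ∈ S.rules := by
  refine S.cut_single (S.modusPonens φ ψ) ?_
  intro γ hγ
  rcases Finset.mem_insert.1 hγ with rfl | hγ
  · exact h
  · rw [Finset.mem_singleton.1 hγ]; exact h'

theorem RuleSystem.nec {Γ : Finset F} {φ : F} (h : ((Γ, {φ}) : Rule F) ∈ S.rules) :
    ((Γ, {ModalFrm.box φ}) : Rule F) ∈ S.rules := by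
  refine S.cut_single (S.necessitation φ) ?_
  intro γ hγ
  rw [Finset.mem_singleton.1 hγ]; exact h

theorem RuleSystem.subset_generate (X : Set (Rule F)) : X ⊆ (RuleSystem.generate X).rules :=
  fun _ hr _ hS => hS hr

theorem RuleSystem.generate_le {X : Set (Rule F)} {S : RuleSystem F} (h : X ⊆ S.rules) :
    RuleSystem.generate X ≤ S :=
  sInf_le h

end

/-! ## Truth in Kripke frames -/

section

universe u

/-- Truth of a formula at a point, for Kripke frames in an arbitrary universe. -/
def satSet {W : Type u} (R : W → W → Prop) (V : ℕ → Set W) : ClmFrm → Set W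
  | .var n => V n
  | .bot => ∅
  | .top => Set.univ
  | .and a b => satSet R V a ∩ satSet R V b
  | .neg a => (satSet R V a)ᶜ
  | .box a => {w | ∀ v, R w v → v ∈ satSet R V a}

variable {W : Type u} {R : W → W → Prop} {V : ℕ → Set W} {w : W}

theorem sat_iff_mem_satSet {W : Type} {R : W → W → Prop} {V : ℕ → Set W} {w : W} (φ : ClmFrm) :
    φ.Sat R V w ↔ w ∈ satSet R V φ := by
  induction φ generalizing w with
  | var n => rfl
  | bot => rfl
  | top => simp [ClmFrm.Sat, satSet]
  | and a b iha ihb => simp [ClmFrm.Sat, satSet, iha, ihb]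
  | neg a iha => simp [ClmFrm.Sat, satSet, iha]
  | box a iha => simp [ClmFrm.Sat, satSet, iha]

@[simp] theorem satSet_var (n : ℕ) : satSet R V (.var n) = V n := rfl

@[simp] theorem satSet_bot : satSet R V .bot = ∅ := rfl

@[simp] theorem satSet_top : satSet R V .top = Set.univ := rfl

@[simp] theorem satSet_and (a b : ClmFrm) :
    satSet R V (.and a b) = satSet R V a ∩ satSet R V b := rfl

@[simp] theorem satSet_neg (a : ClmFrm) : satSet R V (.neg a) = (satSet R V a)ᶜ := rfl

@[simp] theorem mem_satSet_box (a : ClmFrm) :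
    w ∈ satSet R V (.box a) ↔ ∀ v, R w v → v ∈ satSet R V a := Iff.rfl

@[simp] theorem satSet_or (a b : ClmFrm) :
    satSet R V (a.or b) = satSet R V a ∪ satSet R V b := by
  simp [ClmFrm.or, Set.compl_inter]

@[simp] theorem mem_satSet_imp (a b : ClmFrm) :
    w ∈ satSet R V (a.imp b) ↔ (w ∈ satSet R V a → w ∈ satSet R V b) := by
  simp [ClmFrm.imp]

@[simp] theorem mem_satSet_boxPlus (a : ClmFrm) :
    w ∈ satSet R V a.boxPlus ↔ w ∈ satSet R V a ∧ ∀ v, R w v → v ∈ satSet R V a := Iff.rfl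

theorem satSet_subst (s : ℕ → ClmFrm) (φ : ClmFrm) :
    satSet R V (φ.subst s) = satSet R (fun n => satSet R V (s n)) φ := by
  induction φ with
  | var n => rfl
  | bot => rfl
  | top => rfl
  | and a b iha ihb => simp [ClmFrm.subst, iha, ihb]
  | neg a iha => simp [ClmFrm.subst, iha]
  | box a iha => ext; simp [ClmFrm.subst, iha]

/-- Truth is preserved under passing to a generated subframe. -/
theorem mem_satSet_subframe {D : Set W} (hD : ∀ x ∈ D, ∀ y, R x y → y ∈ D) (φ : ClmFrm) (w : D) :
    w ∈ satSet (fun a b : D => R a b) (fun n => Subtype.val ⁻¹' V n) φ ↔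
      (w : W) ∈ satSet R V φ := by
  induction φ generalizing w with
  | var n => rfl
  | bot => rfl
  | top => simp
  | and a b iha ihb => simp [iha, ihb]
  | neg a iha => simp [iha]
  | box a iha =>
    simp only [mem_satSet_box, iha]
    exact ⟨fun h v hv => h ⟨v, hD _ w.2 v hv⟩ hv, fun h v hv => h v hv⟩

/-- Variables, implications and ⊠ are translated to formulas guarded by □⁺ or □, which persist by
transitivity; ∧ and ∨ preserve persistence. -/
theorem mem_satSet_transl_of_rel (hR : ∀ x y z, R x y → R y z → R x z) (φ : SimFrm) {v : W}
    (hw : w ∈ satSet R V (transl φ)) (hv : R w v) : v ∈ satSet R V (transl φ) := by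
  induction φ with
  | var n => exact ⟨hw.2 v hv, fun z hz => hw.2 z (hR _ _ _ hv hz)⟩
  | bot => exact hw
  | top => trivial
  | and a b iha ihb => exact ⟨iha hw.1, ihb hw.2⟩
  | or a b iha ihb =>
    simp only [transl, satSet_or] at hw ⊢
    exact hw.imp iha ihb
  | imp a b => exact ⟨hw.2 v hv, fun z hz => hw.2 z (hR _ _ _ hv hz)⟩
  | box a => exact fun z hz => hw z (hR _ _ _ hv hz)

theorem mem_satSet_transl_imp (a b : SimFrm) :
    w ∈ satSet R V (transl (a.imp b)) ↔ (w ∈ satSet R V (transl a) → w ∈ satSet R V (transl b)) ∧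
      ∀ v, R w v → v ∈ satSet R V (transl a) → v ∈ satSet R V (transl b) := by
  simp [transl, imp_iff_not_or]

/-- The two sides differ syntactically only in an extra □⁺ in front of each `transl (s n)`, which is
harmless because translations are persistent. -/
theorem satSet_transl_subst (hR : ∀ x y z, R x y → R y z → R x z) (s : ℕ → SimFrm) (φ : SimFrm) :
    satSet R V (transl (φ.subst s)) = satSet R V ((transl φ).subst fun n => transl (s n)) := by
  rw [satSet_subst]
  induction φ with
  | var n =>
    ext w
    simp only [SimFrm.subst, transl, mem_satSet_boxPlus, satSet_var]
    exact ⟨fun h => ⟨h, fun v hv => mem_satSet_transl_of_rel hR _ h hv⟩, And.left⟩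
  | bot => rfl
  | top => rfl
  | and a b iha ihb => simp [SimFrm.subst, transl, iha, ihb]
  | or a b iha ihb => simp [SimFrm.subst, transl, iha, ihb]
  | imp a b iha ihb => ext; simp [SimFrm.subst, transl, iha, ihb]
  | box a iha => ext; simp [SimFrm.subst, transl, iha]

end

/-! ## Global consequence over transitive frames -/

/-- Global consequence over all transitive Kripke frames. -/
def GlobalConsequence (Γ : Finset ClmFrm) (φ : ClmFrm) : Prop :=
  ∀ (W : Type) (R : W → W → Prop), (∀ x y z, R x y → R y z → R x z) → ∀ V : ℕ → Set W,
    (∀ γ ∈ Γ, ∀ w, w ∈ satSet R V γ) → ∀ w, w ∈ satSet R V φ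

/-- The conjunction of a list of formulas. -/
def ClmFrm.conj : List ClmFrm → ClmFrm
  | [] => .top
  | a :: l => .and a (conj l)

/-- The disjunction of a list of formulas. -/
def ClmFrm.disj : List ClmFrm → ClmFrm
  | [] => .bot
  | a :: l => .or a (disj l)

universe u in
theorem mem_satSet_conj {W : Type u} {R : W → W → Prop} {V : ℕ → Set W} {w : W}
    (l : List ClmFrm) : w ∈ satSet R V (.conj l) ↔ ∀ φ ∈ l, w ∈ satSet R V φ := by
  induction l with
  | nil => simp [ClmFrm.conj]
  | cons a l ih => simp [ClmFrm.conj, ih]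

universe u in
theorem mem_satSet_disj {W : Type u} {R : W → W → Prop} {V : ℕ → Set W} {w : W}
    (l : List ClmFrm) : w ∈ satSet R V (.disj l) ↔ ∃ φ ∈ l, w ∈ satSet R V φ := by
  induction l with
  | nil => simp [ClmFrm.disj]
  | cons a l ih => simp [ClmFrm.disj, ih]

section

variable {M : RuleSystem ClmFrm} (hM : K4 ≤ M)
include hM

theorem mem_rules_of_transitiveValid {φ : ClmFrm} (h : φ.TransitiveValid) (Γ : Finset ClmFrm) :
    ((Γ, {φ}) : Rule ClmFrm) ∈ M.rules :=
  M.mono (hM (RuleSystem.subset_generate _ ⟨φ, h, rfl⟩)) (Finset.empty_subset _) subset_rfl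

theorem conj_mem_rules {Γ : Finset ClmFrm} (l : List ClmFrm) (hl : ∀ φ ∈ l, φ ∈ Γ) :
    ((Γ, {.conj l}) : Rule ClmFrm) ∈ M.rules := by
  induction l with
  | nil =>
    exact mem_rules_of_transitiveValid hM (fun W R _ V w => by simp [ClmFrm.conj, ClmFrm.Sat]) _
  | cons a l ih =>
    have h : (ClmFrm.imp a (ClmFrm.imp (.conj l) (.conj (a :: l)))).TransitiveValid := by
      intro W R _ V w
      rw [sat_iff_mem_satSet]
      simp only [mem_satSet_imp, ClmFrm.conj, satSet_and]
      exact fun h h' => ⟨h, h'⟩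
    refine M.mp (ih fun φ hφ => hl φ (List.mem_cons_of_mem _ hφ)) ?_
    exact M.mp (M.mem_of_mem (hl a List.mem_cons_self) (Finset.mem_singleton_self _))
      (mem_rules_of_transitiveValid hM h Γ)

/-- Deduction theorem for K4: with c the conjunction of Γ, the formula c → (□c → φ) is valid in
transitive frames, since c ∧ □c at w makes Γ true throughout the subframe generated by w.
Necessitation then supplies □c. -/
theorem GlobalConsequence.mem_rules {Γ : Finset ClmFrm} {φ : ClmFrm}
    (h : GlobalConsequence Γ φ) : ((Γ, {φ}) : Rule ClmFrm) ∈ M.rules := by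
  set c := ClmFrm.conj Γ.toList with hc
  have hcM : ((Γ, {c}) : Rule ClmFrm) ∈ M.rules := conj_mem_rules hM _ fun φ hφ => by simpa using hφ
  have hv : (ClmFrm.imp c (ClmFrm.imp (.box c) φ)).TransitiveValid := by
    intro W R hR V w
    rw [sat_iff_mem_satSet]
    simp only [mem_satSet_imp, mem_satSet_box]
    intro h1 h2
    let D : Set W := {v | v = w ∨ R w v}
    have hD : ∀ x ∈ D, ∀ y, R x y → y ∈ D := by
      rintro x (rfl | hx) y hy
      · exact Or.inr hy
      · exact Or.inr (hR _ _ _ hx hy)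
    have hcD : ∀ x ∈ D, x ∈ satSet R V c := by
      rintro x (rfl | hx)
      · exact h1
      · exact h2 x hx
    refine (mem_satSet_subframe hD φ ⟨w, Or.inl rfl⟩).1 ?_
    refine h D _ (fun x y z => hR x y z) _ ?_ _
    intro γ hγ x
    rw [mem_satSet_subframe hD]
    exact (mem_satSet_conj _).1 (hcD x x.2) γ (by simpa using hγ)
  exact M.mp (M.nec hcM) (M.mp hcM (mem_rules_of_transitiveValid hM hv Γ))

end

/-! ## The rule system `ρM` -/

/-- Soundness of the Gödel translation, with the reflexive closure of R as intuitionistic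
accessibility; persistence is what `mono` contributes. -/
theorem transl_toSim_valid {φ : IntFrm} (h : φ.Provable) {W : Type} {R : W → W → Prop}
    (hR : ∀ x y z, R x y → R y z → R x z) (V : ℕ → Set W) (w : W) :
    w ∈ satSet R V (transl φ.toSim) := by
  have mono := fun (φ : SimFrm) (w v : W) => mem_satSet_transl_of_rel (V := V) (w := w) (v := v) hR φ
  induction h generalizing w with
  | k a b =>
    simp only [IntFrm.toSim, mem_satSet_transl_imp]
    grind
  | s a b c =>
    simp only [IntFrm.toSim, mem_satSet_transl_imp]
    grind
  | andLeft a b =>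
    simp only [IntFrm.toSim, mem_satSet_transl_imp]
    exact ⟨fun h => h.1, fun _ _ h => h.1⟩
  | andRight a b =>
    simp only [IntFrm.toSim, mem_satSet_transl_imp]
    exact ⟨fun h => h.2, fun _ _ h => h.2⟩
  | andIntro a b =>
    simp only [IntFrm.toSim, mem_satSet_transl_imp]
    simp only [transl, satSet_and, Set.mem_inter_iff]
    grind
  | orLeft a b =>
    simp only [IntFrm.toSim, mem_satSet_transl_imp]
    simp only [transl, satSet_or, Set.mem_union]
    exact ⟨Or.inl, fun _ _ => Or.inl⟩
  | orRight a b =>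
    simp only [IntFrm.toSim, mem_satSet_transl_imp]
    simp only [transl, satSet_or, Set.mem_union]
    exact ⟨Or.inr, fun _ _ => Or.inr⟩
  | orElim a b c =>
    simp only [IntFrm.toSim, mem_satSet_transl_imp (a := a.toSim.or b.toSim),
      mem_satSet_transl_imp]
    simp only [transl, satSet_or, Set.mem_union]
    grind
  | botElim a =>
    simp only [IntFrm.toSim, mem_satSet_transl_imp]
    exact ⟨fun h => h.elim, fun _ _ h => h.elim⟩
  | topIntro => trivial
  | mp a b _ _ iha ihb => exact (((mem_satSet_transl_imp _ _).1 (iha w)).1) (ihb w)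

section

variable {M : RuleSystem ClmFrm} (hM : K4 ≤ M)
include hM

/-- Translation commutes with substitution only up to interderivability, which is what structurality
of ρM requires. -/
theorem transl_subst_mem_rules (s : ℕ → SimFrm) (φ : SimFrm) :
    (({transl (φ.subst s)}, {(transl φ).subst fun n => transl (s n)}) : Rule ClmFrm) ∈ M.rules ∧
    (({(transl φ).subst fun n => transl (s n)}, {transl (φ.subst s)}) : Rule ClmFrm) ∈ M.rules := by
  constructor <;> refine GlobalConsequence.mem_rules hM fun W R hR V h w => ?_
  · rw [← satSet_transl_subst hR]; exact h _ (Finset.mem_singleton_self _) w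
  · rw [satSet_transl_subst hR]; exact h _ (Finset.mem_singleton_self _) w

/-- `ρM` as a rule system. -/
def rhoSystem : RuleSystem SimFrm where
  rules := rho M
  structurality := by
    intro r hr s
    refine M.replace (M.structurality _ hr fun n => transl (s n)) ?_ ?_
    · simp only [Rule.map, Finset.mem_image]
      rintro _ ⟨_, ⟨a, ha, rfl⟩, rfl⟩
      exact M.mono (transl_subst_mem_rules hM s a).1 (by
        rw [Finset.singleton_subset_iff]
        exact Finset.mem_image_of_mem _ (Finset.mem_image_of_mem (ModalFrm.subst s) ha)) subset_rfl
    · simp only [Rule.map, Finset.mem_image]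
      rintro _ ⟨_, ⟨a, ha, rfl⟩, rfl⟩
      exact ⟨_, ⟨_, ⟨a, ha, rfl⟩, rfl⟩, M.mono (transl_subst_mem_rules hM s a).2
        (Finset.singleton_subset_iff.2 (Finset.mem_insert_self _ _)) subset_rfl⟩
  reflexivity φ := M.reflexivity (transl φ)
  monotonicity Γ Δ Γ' Δ' h := by
    simp only [rho, Rule.map, Set.mem_ofPred_eq, Finset.image_union] at h ⊢
    exact M.monotonicity _ _ _ _ h
  cut Γ Δ φ h h' := by
    simp only [rho, Rule.map, Set.mem_ofPred_eq, Finset.image_insert] at h h' ⊢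
    exact M.cut _ _ _ h h'
  modusPonens φ ψ := by
    simp only [rho, Rule.map, Set.mem_ofPred_eq, Finset.image_insert, Finset.image_singleton]
    refine GlobalConsequence.mem_rules hM fun W R hR V h w => ?_
    have h1 := h (transl φ) (by simp) w
    have h2 := h (transl (φ.imp ψ)) (Finset.mem_insert_of_mem (Finset.mem_singleton_self _)) w
    exact ((mem_satSet_transl_imp _ _).1 h2).1 h1
  necessitation φ := M.necessitation (transl φ)

theorem mHC_le_rhoSystem : mHC ≤ rhoSystem hM := by
  refine RuleSystem.generate_le ?_
  have key : ∀ φ : SimFrm, (∀ (W : Type) (R : W → W → Prop), (∀ x y z, R x y → R y z → R x z) →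
      ∀ (V : ℕ → Set W) (w : W), w ∈ satSet R V (transl φ)) →
      Rule.fact φ ∈ (rhoSystem hM).rules := by
    intro φ h
    exact mem_rules_of_transitiveValid hM (φ := transl φ)
      (fun W R hR V w => (sat_iff_mem_satSet _).2 (h W R hR V w)) _
  rintro _ (⟨φ, hφ, rfl⟩ | rfl | rfl | rfl)
  · exact key _ fun W R hR V w => transl_toSim_valid hφ hR V w
  -- For ⊠p → (q ∨ (q → p)): if □□⁺p holds at a point, all its successors satisfy □⁺p, so q → p can
  -- fail only at the point itself, and only if □⁺q holds there.
  all_goals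
    refine key _ fun W R hR V w => ?_
    simp only [mem_satSet_transl_imp]
    simp only [transl, mem_satSet_box, mem_satSet_boxPlus, satSet_or, satSet_neg, satSet_var,
      Set.mem_union, Set.mem_compl_iff]
    grind

end

/-! ## Algebras of upsets and their Boolean closure -/

section

universe u

variable {W : Type u}

/-- `□⁺U`, for a set `U` of points of the frame `(W, R)`. -/
def boxPlusSet (R : W → W → Prop) (U : Set W) : Set W := {w | w ∈ U ∧ ∀ v, R w v → v ∈ U}

/-- A family of upsets of a transitive frame that is a bounded sublattice and is closed under the
Heyting implication and under `□`. -/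
structure IsUpsetAlgebra (R : W → W → Prop) (H : Set (Set W)) : Prop where
  trans : ∀ x y z, R x y → R y z → R x z
  upset : ∀ U ∈ H, ∀ x ∈ U, ∀ y, R x y → y ∈ U
  sublattice : IsSublattice H
  bot_mem : ⊥ ∈ H
  top_mem : ⊤ ∈ H
  himp_mem : ∀ U ∈ H, ∀ V ∈ H, boxPlusSet R (Uᶜ ∪ V) ∈ H
  box_mem : ∀ U ∈ H, {w | ∀ v, R w v → v ∈ U} ∈ H

variable {R : W → W → Prop} {H : Set (Set W)} (hH : IsUpsetAlgebra R H)
include hH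

/-- The interior of a Boolean combination of members of an upset algebra is again a member. -/
theorem IsUpsetAlgebra.boxPlusSet_mem {A : Set W} (hA : A ∈ BooleanSubalgebra.closure H) :
    boxPlusSet R A ∈ H := by
  classical
  -- The complement of A is a finite union of differences U \ U' of members of H, so A is a finite
  -- intersection of sets Uᶜ ∪ U'. Now □⁺ commutes with intersections, and □⁺(Uᶜ ∪ U') is the
  -- Heyting implication.
  obtain ⟨t, ht⟩ := (BooleanSubalgebra.mem_closure_iff_sup_sdiff hH.sublattice hH.bot_mem
    hH.top_mem).1 (BooleanSubalgebra.compl_mem hA)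
  rw [← compl_compl A, ht]
  clear ht
  induction t using Finset.induction with
  | empty =>
    convert hH.top_mem
    ext; simp [boxPlusSet]
  | insert x t _ ih =>
    have := hH.sublattice.infClosed (hH.himp_mem _ x.1.2 _ x.2.2) ih
    convert this using 1
    ext w
    simp only [boxPlusSet, Finset.sup_insert, Set.mem_ofPred_eq, Set.inf_eq_inter, Set.sup_eq_union,
      Set.mem_inter_iff, Set.mem_compl_iff, Set.mem_union, Set.mem_sdiff]
    grind

/-- By transitivity □A = □□⁺A, and □⁺A already lies in H. -/
theorem IsUpsetAlgebra.box_mem_closure {A : Set W} (hA : A ∈ BooleanSubalgebra.closure H) :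
    {w | ∀ v, R w v → v ∈ A} ∈ BooleanSubalgebra.closure H := by
  have : {w | ∀ v, R w v → v ∈ A} = {w | ∀ v, R w v → v ∈ boxPlusSet R A} := by
    ext w
    exact ⟨fun h v hv => ⟨h v hv, fun z hz => h z (hH.trans _ _ _ hv hz)⟩, fun h v hv => (h v hv).1⟩
  rw [this]
  exact BooleanSubalgebra.subset_closure (hH.box_mem _ (hH.boxPlusSet_mem hA))

theorem IsUpsetAlgebra.satSet_mem_closure {V : ℕ → Set W}
    (hV : ∀ n, V n ∈ BooleanSubalgebra.closure H) (φ : ClmFrm) :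
    satSet R V φ ∈ BooleanSubalgebra.closure H := by
  induction φ with
  | var n => exact hV n
  | bot => exact BooleanSubalgebra.bot_mem
  | top => exact BooleanSubalgebra.top_mem
  | and a b iha ihb => exact BooleanSubalgebra.infClosed _ iha ihb
  | neg a iha => exact BooleanSubalgebra.compl_mem iha
  | box a iha => exact hH.box_mem_closure iha

end

/-! ## The frame of all pointed transitive models -/

/-- A transitive Kripke model with a distinguished point. -/
structure PointedModel : Type 1 where
  W : Type
  R : W → W → Prop
  trans : ∀ x y z, R x y → R y z → R x z
  V : ℕ → Set W
  point : W

/-- Moving the distinguished point along the accessibility relation. -/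
def PointedModel.Rel (m n : PointedModel) : Prop :=
  ∃ v, m.R m.point v ∧ n = { m with point := v }

/-- The canonical valuation on pointed models. -/
def PointedModel.val (n : ℕ) : Set PointedModel := {m | m.point ∈ m.V n}

theorem PointedModel.mem_satSet (φ : ClmFrm) (m : PointedModel) :
    m ∈ satSet Rel val φ ↔ m.point ∈ satSet m.R m.V φ := by
  induction φ generalizing m with
  | var n => rfl
  | bot => rfl
  | top => simp
  | and a b iha ihb => simp [iha, ihb]
  | neg a iha => simp [iha]
  | box a iha =>
    simp only [mem_satSet_box, iha]
    exact ⟨fun h v hv => h _ ⟨v, hv, rfl⟩, by rintro h _ ⟨v, hv, rfl⟩; exact h v hv⟩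

theorem PointedModel.rel_trans (x y z : PointedModel) (h : Rel x y) (h' : Rel y z) : Rel x z := by
  obtain ⟨v, hv, rfl⟩ := h
  obtain ⟨u, hu, rfl⟩ := h'
  exact ⟨u, x.trans _ _ _ hv hu, rfl⟩

/-- In this universal model, equality of truth sets is equivalence at every point of every
transitive model, so set-theoretic facts about upset algebras become facts about formulas. -/
theorem PointedModel.isUpsetAlgebra :
    IsUpsetAlgebra Rel (Set.range fun a => satSet Rel val (transl a)) where
  trans := rel_trans
  upset := by
    rintro _ ⟨a, rfl⟩ x hx y hy
    exact mem_satSet_transl_of_rel rel_trans a hx hy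
  sublattice := by
    constructor
    · rintro _ ⟨a, rfl⟩ _ ⟨b, rfl⟩
      exact ⟨a.or b, by simp [transl]⟩
    · rintro _ ⟨a, rfl⟩ _ ⟨b, rfl⟩
      exact ⟨a.and b, by simp [transl]⟩
  bot_mem := ⟨.bot, rfl⟩
  top_mem := ⟨.top, rfl⟩
  himp_mem := by
    rintro _ ⟨a, rfl⟩ _ ⟨b, rfl⟩
    exact ⟨a.imp b, by ext; simp [transl, boxPlusSet]⟩
  box_mem := by
    rintro _ ⟨a, rfl⟩
    exact ⟨a.box, rfl⟩

/-! ## Truth tables over open formulas -/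

/-- The formula saying that the set of all `k < m` for which `□⁺ k` is true has the property
`P`. -/
noncomputable def truthTable (m : ℕ) (P : Finset ℕ → Prop) : ClmFrm := by
  classical
  exact .disj ((((Finset.range m).powerset.filter P).toList).map fun π =>
    .conj ((Finset.range m).toList.map fun k =>
      if k ∈ π then ClmFrm.boxPlus (.var k) else .neg (ClmFrm.boxPlus (.var k))))

section

universe u

variable {W : Type u} {R : W → W → Prop} {V : ℕ → Set W} {w : W}

open Classical in
theorem mem_satSet_truthTable (m : ℕ) (P : Finset ℕ → Prop) :
    w ∈ satSet R V (truthTable m P) ↔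
      P {k ∈ Finset.range m | w ∈ satSet R V (ClmFrm.boxPlus (.var k))} := by
  have key : ∀ π ∈ (Finset.range m).powerset,
      (w ∈ satSet R V (.conj ((Finset.range m).toList.map fun k =>
        if k ∈ π then ClmFrm.boxPlus (.var k) else .neg (ClmFrm.boxPlus (.var k)))) ↔
      π = ({k ∈ Finset.range m | w ∈ satSet R V (ClmFrm.boxPlus (.var k))} : Finset ℕ)) := by
    intro π hπ
    rw [Finset.mem_powerset] at hπ
    rw [mem_satSet_conj]
    simp only [List.mem_map, Finset.mem_toList, forall_exists_index, and_imp,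
      forall_apply_eq_imp_iff₂, Finset.ext_iff, Finset.mem_filter]
    refine forall_congr' fun k => ?_
    by_cases hk : k ∈ π
    · simp only [hk, if_true, hπ hk, true_and, true_iff, true_imp_iff]
    · simp only [hk, if_false, false_iff, not_and]
      exact Iff.rfl
  simp only [truthTable, mem_satSet_disj, List.mem_map, Finset.mem_toList, Finset.mem_filter]
  constructor
  · rintro ⟨_, ⟨π, ⟨hπ, hP⟩, rfl⟩, h⟩
    rwa [← (key π hπ).1 h]
  · intro hP
    have hmem := Finset.mem_powerset.2
      (Finset.filter_subset (fun k => w ∈ satSet R V (ClmFrm.boxPlus (.var k))) (Finset.range m))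
    exact ⟨_, ⟨_, ⟨hmem, hP⟩, rfl⟩, (key _ hmem).2 rfl⟩

end

theorem PointedModel.satSet_truthTable_mem (m : ℕ) (P : Finset ℕ → Prop) :
    satSet Rel val (truthTable m P) ∈
      BooleanSubalgebra.closure (Set.range fun a => satSet Rel val (transl a)) := by
  have conj : ∀ l : List ClmFrm, (∀ a ∈ l, satSet Rel val a ∈
      BooleanSubalgebra.closure (Set.range fun a => satSet Rel val (transl a))) →
      satSet Rel val (.conj l) ∈
        BooleanSubalgebra.closure (Set.range fun a => satSet Rel val (transl a)) := by
    intro l hl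
    induction l with
    | nil => exact BooleanSubalgebra.top_mem
    | cons a l ih =>
      exact BooleanSubalgebra.infClosed _ (hl a List.mem_cons_self)
        (ih fun b hb => hl b (List.mem_cons_of_mem _ hb))
  have disj : ∀ l : List ClmFrm, (∀ a ∈ l, satSet Rel val a ∈
      BooleanSubalgebra.closure (Set.range fun a => satSet Rel val (transl a))) →
      satSet Rel val (.disj l) ∈
        BooleanSubalgebra.closure (Set.range fun a => satSet Rel val (transl a)) := by
    intro l hl
    induction l with
    | nil => exact BooleanSubalgebra.bot_mem
    | cons a l ih =>
      rw [ClmFrm.disj, satSet_or]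
      exact BooleanSubalgebra.supClosed _ (hl a List.mem_cons_self)
        (ih fun b hb => hl b (List.mem_cons_of_mem _ hb))
  have hvar : ∀ k, satSet Rel val (ClmFrm.boxPlus (.var k)) ∈
      BooleanSubalgebra.closure (Set.range fun a => satSet Rel val (transl a)) :=
    fun k => BooleanSubalgebra.subset_closure ⟨.var k, rfl⟩
  refine disj _ fun a ha => ?_
  obtain ⟨π, _, rfl⟩ := List.mem_map.1 ha
  refine conj _ fun b hb => ?_
  obtain ⟨k, _, rfl⟩ := List.mem_map.1 hb
  split_ifs
  · exact hvar k
  · exact BooleanSubalgebra.compl_mem (hvar k)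

/-- A formula all of whose variables are replaced by Boolean combinations of open formulas is
globally equivalent, over transitive frames, to the translation of some formula. -/
theorem exists_transl_equiv (m : ℕ) (P : ℕ → Finset ℕ → Prop) (φ : ClmFrm) :
    ∃ a : SimFrm, ∀ (W : Type) (R : W → W → Prop), (∀ x y z, R x y → R y z → R x z) →
      ∀ (V : ℕ → Set W) (w : W), w ∈ satSet R V (transl a) ↔
        w ∈ satSet R V (φ.subst fun n => truthTable m (P n)).boxPlus := by
  have h := PointedModel.isUpsetAlgebra.satSet_mem_closure
    (fun n => PointedModel.satSet_truthTable_mem m (P n)) φ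
  rw [← satSet_subst] at h
  obtain ⟨a, ha⟩ := PointedModel.isUpsetAlgebra.boxPlusSet_mem h
  refine ⟨a, fun W R hR V w => ?_⟩
  -- An arbitrary model with a chosen point is itself a point of the universal model.
  have := Set.ext_iff.1 ha ⟨W, R, hR, V, w⟩
  exact (PointedModel.mem_satSet (transl a) ⟨W, R, hR, V, w⟩).symm.trans
    (this.trans (PointedModel.mem_satSet (ClmFrm.boxPlus _) ⟨W, R, hR, V, w⟩))

/-! ## Subformulas -/

/-- The subformulas of a formula. -/
def ClmFrm.subformulas : ClmFrm → Finset ClmFrm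
  | .var n => {.var n}
  | .bot => {.bot}
  | .top => {.top}
  | .and a b => insert (.and a b) (a.subformulas ∪ b.subformulas)
  | .neg a => insert (.neg a) a.subformulas
  | .box a => insert (.box a) a.subformulas

theorem ClmFrm.mem_subformulas_self (φ : ClmFrm) : φ ∈ φ.subformulas := by
  cases φ <;> simp [ClmFrm.subformulas]

theorem ClmFrm.subformulas_subset {φ ψ : ClmFrm} (h : ψ ∈ φ.subformulas) :
    ψ.subformulas ⊆ φ.subformulas := by
  induction φ with
  | var n => rw [Finset.mem_singleton.1 h]
  | bot => rw [Finset.mem_singleton.1 h]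
  | top => rw [Finset.mem_singleton.1 h]
  | and a b iha ihb =>
    rcases Finset.mem_insert.1 h with rfl | h
    · exact subset_rfl
    · refine subset_trans ?_ (Finset.subset_insert _ _)
      rcases Finset.mem_union.1 h with h | h
      · exact (iha h).trans Finset.subset_union_left
      · exact (ihb h).trans Finset.subset_union_right
  | neg a iha =>
    rcases Finset.mem_insert.1 h with rfl | h
    · exact subset_rfl
    · exact (iha h).trans (Finset.subset_insert _ _)
  | box a iha =>
    rcases Finset.mem_insert.1 h with rfl | h
    · exact subset_rfl
    · exact (iha h).trans (Finset.subset_insert _ _)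

/-- Finite sets of formulas closed under subformulas. -/
def SubformulaClosed (Θ : Finset ClmFrm) : Prop := ∀ φ ∈ Θ, φ.subformulas ⊆ Θ

theorem subformulaClosed_biUnion (Γ : Finset ClmFrm) :
    SubformulaClosed (Γ.biUnion ClmFrm.subformulas) := by
  intro φ hφ
  obtain ⟨γ, hγ, h⟩ := Finset.mem_biUnion.1 hφ
  exact (ClmFrm.subformulas_subset h).trans (Finset.subset_biUnion_of_mem _ hγ)

/-! ## Relabelling the points of a model of Grzegorczyk's axiom -/

/-- The instance of Grzegorczyk's axiom for the formula `a`. -/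
def grz (a : ClmFrm) : ClmFrm := .imp (.box (.imp (.box (.imp a (.box a))) a)) (.box a)

/-- The formula true at the points where exactly the formulas in `i` among those in `Θ` are
true. -/
noncomputable def typeFrm (Θ i : Finset ClmFrm) : ClmFrm :=
  .conj (Θ.toList.map fun ψ => if ψ ∈ i then ψ else .neg ψ)

/-- The set of the formulas used to separate the labels over `Θ`. -/
noncomputable def separators (Θ : Finset ClmFrm) : Finset ClmFrm :=
  Θ ∪ (Θ.powerset.image (fun i => .neg (typeFrm Θ i)) ∪
    Θ.powerset.image fun i => .or (typeFrm Θ i) (ClmFrm.boxPlus (.neg (typeFrm Θ i))))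

open Classical in
/-- The label of a point at which the set of true formulas `□⁺f` with `f ∈ separators Θ` is
given by `a`. -/
noncomputable def label (Θ a : Finset ClmFrm) : Finset ClmFrm :=
  -- For the profile of a point, this asks whether the point is final of type i; then i is its type,
  -- so the choice is unique.
  if h : ∃ i ∈ Θ.powerset, (typeFrm Θ i).or (ClmFrm.boxPlus (.neg (typeFrm Θ i))) ∈ a ∧
      .neg (typeFrm Θ i) ∉ a then h.choose
  -- Otherwise any type realised at or above the point will do, provided it agrees with the point on
  -- the boxed formulas of Θ.
  else if h : ∃ i ∈ Θ.powerset, .neg (typeFrm Θ i) ∉ a ∧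
      ∀ ψ, .box ψ ∈ Θ → (.box ψ ∈ i ↔ .box ψ ∈ a) then h.choose
  -- Never reached for the profile of a point in a transitive model: its own type passes the
  -- previous test.
  else ∅

section

variable {W : Type} {R : W → W → Prop} {V : ℕ → Set W}

open Classical in
/-- The formulas of `Θ` true at a point. -/
noncomputable def trueType (R : W → W → Prop) (V : ℕ → Set W) (Θ : Finset ClmFrm) (w : W) :
    Finset ClmFrm :=
  {ψ ∈ Θ | w ∈ satSet R V ψ}

open Classical in
/-- The label of a point of a model. -/
noncomputable def labelAt (R : W → W → Prop) (V : ℕ → Set W) (Θ : Finset ClmFrm) (w : W) :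
    Finset ClmFrm :=
  label Θ {f ∈ separators Θ | w ∈ satSet R V f.boxPlus}

theorem mem_trueType {Θ : Finset ClmFrm} {w : W} {ψ : ClmFrm} (hψ : ψ ∈ Θ) :
    ψ ∈ trueType R V Θ w ↔ w ∈ satSet R V ψ := by
  simp [trueType, hψ]

theorem trueType_mem_powerset (Θ : Finset ClmFrm) (w : W) :
    trueType R V Θ w ∈ Θ.powerset := by
  simp [trueType]

theorem mem_satSet_typeFrm {Θ i : Finset ClmFrm} (hi : i ∈ Θ.powerset) {w : W} :
    w ∈ satSet R V (typeFrm Θ i) ↔ trueType R V Θ w = i := by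
  rw [Finset.mem_powerset] at hi
  simp only [typeFrm, mem_satSet_conj, List.mem_map, Finset.mem_toList, forall_exists_index,
    and_imp, forall_apply_eq_imp_iff₂, Finset.ext_iff]
  constructor
  · intro h ψ
    by_cases hψ : ψ ∈ Θ
    · rw [mem_trueType hψ]
      have := h ψ hψ
      split_ifs at this with h'
      · exact iff_of_true this h'
      · exact iff_of_false this h'
    · exact iff_of_false (fun h => hψ (Finset.mem_powerset.1 (trueType_mem_powerset Θ w) h))
        fun h => hψ (hi h)
  · intro h ψ hψ
    have := h ψ
    rw [mem_trueType hψ] at this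
    split_ifs with h'
    · exact this.2 h'
    · exact fun h => h' (this.1 h)

/-- The points that have type `i`, and above which type `i` is lost at most once, for ever. -/
def IsFinalOfType (R : W → W → Prop) (V : ℕ → Set W) (Θ i : Finset ClmFrm) (w : W) : Prop :=
  w ∈ satSet R V ((typeFrm Θ i).or (ClmFrm.boxPlus (.neg (typeFrm Θ i)))).boxPlus ∧
    w ∉ satSet R V (ClmFrm.boxPlus (.neg (typeFrm Θ i)))

theorem IsFinalOfType.trueType_eq {Θ i : Finset ClmFrm} (hi : i ∈ Θ.powerset) {w : W}
    (h : IsFinalOfType R V Θ i w) : trueType R V Θ w = i := by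
  rw [← mem_satSet_typeFrm hi]
  have := h.1.1
  rw [satSet_or] at this
  exact this.resolve_right h.2

theorem labelAt_of_isFinalOfType {Θ i : Finset ClmFrm} (hi : i ∈ Θ.powerset) {w : W}
    (h : IsFinalOfType R V Θ i w) : labelAt R V Θ w = i := by
  classical
  have ex : ∃ j ∈ Θ.powerset, (typeFrm Θ j).or (ClmFrm.boxPlus (.neg (typeFrm Θ j))) ∈
      ({f ∈ separators Θ | w ∈ satSet R V f.boxPlus} : Finset ClmFrm) ∧
      .neg (typeFrm Θ j) ∉ ({f ∈ separators Θ | w ∈ satSet R V f.boxPlus} : Finset ClmFrm) := by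
    refine ⟨i, hi, ?_, ?_⟩
    · refine Finset.mem_filter.2 ⟨?_, h.1⟩
      exact Finset.mem_union_right _ (Finset.mem_union_right _ (Finset.mem_image_of_mem _ hi))
    · exact fun h' => h.2 (Finset.mem_filter.1 h').2
  rw [labelAt, label, dif_pos ex]
  obtain ⟨h1, h2, h3⟩ := ex.choose_spec
  rw [← h.trueType_eq hi]
  refine (IsFinalOfType.trueType_eq h1 ⟨(Finset.mem_filter.1 h2).2, fun h' => h3 ?_⟩).symm
  refine Finset.mem_filter.2 ⟨?_, h'⟩
  exact Finset.mem_union_right _ (Finset.mem_union_left _ (Finset.mem_image_of_mem _ h1))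

/-- Above every point that sees a given type there is a final point of this type. -/
theorem exists_isFinalOfType {Θ i : Finset ClmFrm} (hi : i ∈ Θ.powerset)
    {w : W} (hgrz : w ∈ satSet R V (grz (.neg (typeFrm Θ i)))) {y : W} (hy : R w y)
    (hyi : trueType R V Θ y = i) : ∃ z, R w z ∧ IsFinalOfType R V Θ i z := by
  rw [← mem_satSet_typeFrm hi] at hyi
  simp only [grz, mem_satSet_imp, mem_satSet_box] at hgrz
  by_contra! hz
  -- With t the type formula, Grz for ¬t would give □¬t at w, against y. Its premise holds: a point
  -- z above w with t and □(¬t → □¬t) would be final.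
  refine hgrz (fun z hwz hz' => ?_) y hy hyi
  by_contra hzi
  rw [satSet_neg, Set.notMem_compl_iff] at hzi
  refine hz z hwz ⟨?_, fun h => h.1 hzi⟩
  simp only [mem_satSet_boxPlus, satSet_or, Set.mem_union]
  refine ⟨Or.inl hzi, fun v hv => ?_⟩
  by_cases hvi : v ∈ satSet R V (typeFrm Θ i)
  · exact Or.inl hvi
  · exact Or.inr ⟨hvi, hz' v hv hvi⟩

variable (hR : ∀ x y z, R x y → R y z → R x z)
include hR

/-- A label is always a genuine type, so it respects the Boolean connectives. It is realised at w or
above w, and it has the same boxed formulas as w; these are the two facts used in the □ case of the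
truth lemma. -/
theorem exists_trueType_eq_labelAt (Θ : Finset ClmFrm) (w : W) :
    ∃ z, (z = w ∨ R w z) ∧ trueType R V Θ z = labelAt R V Θ w ∧
      ∀ ψ, .box ψ ∈ Θ → (.box ψ ∈ labelAt R V Θ w ↔ w ∈ satSet R V (.box ψ)) := by
  classical
  by_cases hfin : ∃ i ∈ Θ.powerset, IsFinalOfType R V Θ i w
  · obtain ⟨i, hi, h⟩ := hfin
    refine ⟨w, Or.inl rfl, ?_⟩
    rw [labelAt_of_isFinalOfType hi h, ← h.trueType_eq hi]
    exact ⟨rfl, fun ψ hψ => mem_trueType hψ⟩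
  · have sep : ∀ i ∈ Θ.powerset, (.neg (typeFrm Θ i) ∈
        ({f ∈ separators Θ | w ∈ satSet R V f.boxPlus} : Finset ClmFrm) ↔
        w ∈ satSet R V (ClmFrm.boxPlus (.neg (typeFrm Θ i)))) := by
      intro i hi
      simp only [Finset.mem_filter, and_iff_right_iff_imp]
      exact fun _ => Finset.mem_union_right _
        (Finset.mem_union_left _ (Finset.mem_image_of_mem _ hi))
    have box : ∀ ψ, .box ψ ∈ Θ → (.box ψ ∈
        ({f ∈ separators Θ | w ∈ satSet R V f.boxPlus} : Finset ClmFrm) ↔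
        w ∈ satSet R V (.box ψ)) := by
      intro ψ hψ
      simp only [Finset.mem_filter]
      exact ⟨fun h => h.2.1, fun h => ⟨Finset.mem_union_left _ hψ, h,
        fun v hv z hz => h z (hR _ _ _ hv hz)⟩⟩
    have hno : ¬ ∃ i ∈ Θ.powerset, (typeFrm Θ i).or (ClmFrm.boxPlus (.neg (typeFrm Θ i))) ∈
        ({f ∈ separators Θ | w ∈ satSet R V f.boxPlus} : Finset ClmFrm) ∧
        .neg (typeFrm Θ i) ∉
          ({f ∈ separators Θ | w ∈ satSet R V f.boxPlus} : Finset ClmFrm) := by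
      rintro ⟨i, hi, h1, h2⟩
      exact hfin ⟨i, hi, (Finset.mem_filter.1 h1).2, fun h => h2 ((sep i hi).2 h)⟩
    -- The type of w itself is a witness.
    have ex : ∃ i ∈ Θ.powerset, .neg (typeFrm Θ i) ∉
        ({f ∈ separators Θ | w ∈ satSet R V f.boxPlus} : Finset ClmFrm) ∧
        ∀ ψ, .box ψ ∈ Θ → (.box ψ ∈ i ↔
          .box ψ ∈ ({f ∈ separators Θ | w ∈ satSet R V f.boxPlus} : Finset ClmFrm)) := by
      have hw := trueType_mem_powerset (R := R) (V := V) Θ w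
      refine ⟨_, hw, ?_, fun ψ hψ => (mem_trueType hψ).trans (box ψ hψ).symm⟩
      rw [sep _ hw]
      exact fun h => h.1 ((mem_satSet_typeFrm hw).2 rfl)
    rw [labelAt, label, dif_neg hno, dif_pos ex]
    obtain ⟨h1, h2, h3⟩ := ex.choose_spec
    rw [sep _ h1, mem_satSet_boxPlus] at h2
    have : ∃ z, (z = w ∨ R w z) ∧ z ∈ satSet R V (typeFrm Θ ex.choose) := by
      by_contra! hz
      exact h2 ⟨hz w (Or.inl rfl), fun v hv => hz v (Or.inr hv)⟩
    obtain ⟨z, hz, hz'⟩ := this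
    exact ⟨z, hz, (mem_satSet_typeFrm h1).1 hz', fun ψ hψ => (h3 ψ hψ).trans (box ψ hψ)⟩

/-- A point that sees no point of its own type is final; otherwise Grz yields a final point of that
type above it. Final points are labelled by their type. -/
theorem exists_labelAt_eq_trueType {Θ : Finset ClmFrm}
    (hgrz : ∀ i ∈ Θ.powerset, ∀ w, w ∈ satSet R V (grz (.neg (typeFrm Θ i)))) (w : W) :
    ∃ y, labelAt R V Θ y = trueType R V Θ w := by
  have hi := trueType_mem_powerset (R := R) (V := V) Θ w
  have hw : w ∈ satSet R V (typeFrm Θ (trueType R V Θ w)) := (mem_satSet_typeFrm hi).2 rfl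
  by_cases hfin : IsFinalOfType R V Θ (trueType R V Θ w) w
  · exact ⟨w, labelAt_of_isFinalOfType hi hfin⟩
  · have : ∃ u, R w u ∧ u ∈ satSet R V (typeFrm Θ (trueType R V Θ w)) := by
      by_contra! hu
      refine hfin ⟨?_, fun h => h.1 hw⟩
      simp only [mem_satSet_boxPlus, satSet_or, Set.mem_union]
      exact ⟨Or.inl hw, fun v hv => Or.inr ⟨hu v hv, fun z hz => hu z (hR _ _ _ hv hz)⟩⟩
    obtain ⟨u, hwu, hu⟩ := this
    obtain ⟨z, -, hz⟩ := exists_isFinalOfType hi (hgrz _ hi w) hwu ((mem_satSet_typeFrm hi).1 hu)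
    exact ⟨z, labelAt_of_isFinalOfType hi hz⟩

/-- Reading the variables off the labels, the true formulas of `Θ` are those in the label. -/
theorem mem_satSet_iff_mem_labelAt {Θ : Finset ClmFrm} (hΘ : SubformulaClosed Θ)
    (hgrz : ∀ i ∈ Θ.powerset, ∀ w, w ∈ satSet R V (grz (.neg (typeFrm Θ i))))
    {V' : ℕ → Set W} (hV' : ∀ n w, w ∈ V' n ↔ .var n ∈ labelAt R V Θ w)
    (φ : ClmFrm) (hφ : φ ∈ Θ) (w : W) :
    w ∈ satSet R V' φ ↔ φ ∈ labelAt R V Θ w := by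
  have sub := hΘ φ hφ
  induction φ generalizing w with
  | var n => exact hV' n w
  | bot =>
    obtain ⟨z, -, hz, -⟩ := exists_trueType_eq_labelAt (V := V) hR Θ w
    rw [← hz, mem_trueType hφ]; rfl
  | top =>
    obtain ⟨z, -, hz, -⟩ := exists_trueType_eq_labelAt (V := V) hR Θ w
    rw [← hz, mem_trueType hφ]; simp
  | and a b iha ihb =>
    have ha : a ∈ Θ := sub (by simp [ClmFrm.subformulas, ClmFrm.mem_subformulas_self])
    have hb : b ∈ Θ := sub (by simp [ClmFrm.subformulas, ClmFrm.mem_subformulas_self])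
    obtain ⟨z, -, hz, -⟩ := exists_trueType_eq_labelAt (V := V) hR Θ w
    have iha : w ∈ satSet R V' a ↔ a ∈ labelAt R V Θ w := iha ha w (hΘ a ha)
    have ihb : w ∈ satSet R V' b ↔ b ∈ labelAt R V Θ w := ihb hb w (hΘ b hb)
    rw [satSet_and, Set.mem_inter_iff, iha, ihb, ← hz, mem_trueType hφ, mem_trueType ha, mem_trueType hb]
    rfl
  | neg a iha =>
    have ha : a ∈ Θ := sub (by simp [ClmFrm.subformulas, ClmFrm.mem_subformulas_self])
    obtain ⟨z, -, hz, -⟩ := exists_trueType_eq_labelAt (V := V) hR Θ w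
    have iha : w ∈ satSet R V' a ↔ a ∈ labelAt R V Θ w := iha ha w (hΘ a ha)
    rw [satSet_neg, Set.mem_compl_iff, iha, ← hz, mem_trueType hφ, mem_trueType ha]
    rfl
  | box a iha =>
    have ha : a ∈ Θ := sub (by simp [ClmFrm.subformulas, ClmFrm.mem_subformulas_self])
    obtain ⟨-, -, -, hbox⟩ := exists_trueType_eq_labelAt (V := V) hR Θ w
    rw [hbox a hφ, mem_satSet_box, mem_satSet_box]
    constructor
    -- The type of y is the label of a final point above w.
    · intro h y hy
      have hi := trueType_mem_powerset (R := R) (V := V) Θ y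
      obtain ⟨z, hwz, hz⟩ := exists_isFinalOfType hi (hgrz _ hi w) hy rfl
      have := (iha ha z (hΘ a ha)).1 (h z hwz)
      rwa [labelAt_of_isFinalOfType hi hz, mem_trueType ha] at this
    -- The label of y is the type of a point at or above y, hence above w.
    · intro h y hy
      refine (iha ha y (hΘ a ha)).2 ?_
      obtain ⟨z, hz, hz', -⟩ := exists_trueType_eq_labelAt (V := V) hR Θ y
      rw [← hz', mem_trueType ha]
      rcases hz with rfl | hz
      · exact h z hy
      · exact h z (hR _ _ _ hy hz)

end

/-- Every finite subformula-closed set has a substitution by Boolean combinations of open formulas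
that preserves, in the models of Grzegorczyk's axiom, truth everywhere in both directions. -/
theorem exists_relabelling {Θ : Finset ClmFrm} (hΘ : SubformulaClosed Θ) :
    ∃ (m : ℕ) (P : ℕ → Finset ℕ → Prop) (e : ℕ → ClmFrm),
      ∀ (W : Type) (R : W → W → Prop), (∀ x y z, R x y → R y z → R x z) → ∀ V : ℕ → Set W,
        (∀ i ∈ Θ.powerset, ∀ w, w ∈ satSet R V (grz (.neg (typeFrm Θ i)))) →
        ∀ φ ∈ Θ, (∀ w, w ∈ satSet R V φ) ↔
          ∀ w, w ∈ satSet R (fun n => satSet R V (e n)) (φ.subst fun n => truthTable m (P n)) := by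
  classical
  let E := (separators Θ).toList
  -- Variable k stands for the k-th separator. The default ⊥ is harmless: the truth tables read only
  -- variables below `E.length`.
  let e : ℕ → ClmFrm := fun k => E.getD k .bot
  have hE : ∀ f, f ∈ separators Θ ↔ ∃ k < E.length, e k = f := by
    intro f
    rw [← Finset.mem_toList, List.mem_iff_getElem]
    refine exists_congr fun k => ?_
    constructor
    · rintro ⟨h, hk⟩
      exact ⟨h, by simp only [e]; rwa [List.getD_eq_getElem _ _ h]⟩
    · rintro ⟨h, hk⟩
      simp only [e] at hk
      rw [List.getD_eq_getElem _ _ h] at hk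
      exact ⟨h, hk⟩
  refine ⟨E.length, fun n π => .var n ∈ label Θ (π.image e), e, fun W R hR V hgrz φ hφ => ?_⟩
  rw [satSet_subst]
  have hprof : ∀ w : W, ({k ∈ Finset.range E.length |
        w ∈ satSet R (fun n => satSet R V (e n)) (ClmFrm.boxPlus (.var k))} : Finset ℕ).image e =
      {f ∈ separators Θ | w ∈ satSet R V f.boxPlus} := by
    intro w
    ext f
    simp only [Finset.mem_image, Finset.mem_filter, Finset.mem_range, hE]
    constructor
    · rintro ⟨k, ⟨hk, h⟩, rfl⟩
      exact ⟨⟨k, hk, rfl⟩, h⟩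
    · rintro ⟨⟨k, hk, rfl⟩, h⟩
      exact ⟨k, ⟨hk, h⟩, rfl⟩
  have key := mem_satSet_iff_mem_labelAt hR hΘ hgrz
    (V' := fun n => satSet R (fun n => satSet R V (e n))
      (truthTable E.length fun π => .var n ∈ label Θ (π.image e)))
    (fun n w => by rw [mem_satSet_truthTable, hprof, labelAt]) φ hφ
  simp only [key]
  constructor
  · intro h w
    obtain ⟨z, -, hz, -⟩ := exists_trueType_eq_labelAt (V := V) hR Θ w
    rw [← hz, mem_trueType hφ]
    exact h z
  · intro h w
    obtain ⟨y, hy⟩ := exists_labelAt_eq_trueType hR hgrz w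
    rw [← mem_trueType hφ, ← hy]
    exact h y

/-! ## Rule systems above `K4.Grz` are determined by their `ρ`-images -/

theorem grz_mem_rules {M : RuleSystem ClmFrm} (hM : K4Grz ≤ M) (a : ClmFrm) :
    Rule.fact (grz a) ∈ M.rules := by
  have h : Rule.fact (grz (.var 0)) ∈ M.rules :=
    hM (le_sup_right (a := K4) (RuleSystem.subset_generate _ rfl))
  have := M.structurality _ h fun _ => a
  rwa [Rule.map, Rule.fact, Finset.image_empty, Finset.image_singleton] at this

/-- Finitely many instances of Grz serve as extra premises, so consequence over transitive frames
suffices and no completeness theorem for K4.Grz is needed. -/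
theorem mem_rules_of_grz {M : RuleSystem ClmFrm} (hM : K4Grz ≤ M) {Γ A : Finset ClmFrm}
    {φ : ClmFrm} (h : GlobalConsequence (Γ ∪ A.image grz) φ) :
    ((Γ, {φ}) : Rule ClmFrm) ∈ M.rules := by
  refine M.cut_single (h.mem_rules (le_sup_left.trans hM)) fun γ hγ => ?_
  rcases Finset.mem_union.1 hγ with hγ | hγ
  · exact M.mem_of_mem hγ (Finset.mem_singleton_self _)
  · obtain ⟨a, _, rfl⟩ := Finset.mem_image.1 hγ
    exact M.mono (grz_mem_rules hM a) (Finset.empty_subset _) subset_rfl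

/-- Inside M, the truth-table substitution makes the rule equivalent to a translated one; the
hypothesis carries this to M', where the substitution `e` recovers the original rule modulo Grz. -/
theorem le_of_rho_subset {M M' : RuleSystem ClmFrm} (hM : K4Grz ≤ M) (hM' : K4Grz ≤ M')
    (h : rho M ⊆ rho M') : M ≤ M' := by
  intro r hr
  have hK : K4 ≤ M := le_sup_left.trans hM
  obtain ⟨m, P, e, hrel⟩ := exists_relabelling (subformulaClosed_biUnion (r.1 ∪ r.2))
  set Θ := (r.1 ∪ r.2).biUnion ClmFrm.subformulas
  have hΘ : ∀ φ ∈ r.1 ∪ r.2, φ ∈ Θ := fun φ hφ =>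
    Finset.mem_biUnion.2 ⟨φ, hφ, φ.mem_subformulas_self⟩
  choose a ha using exists_transl_equiv m P
  have htr : ∀ (W : Type) (R : W → W → Prop), (∀ x y z, R x y → R y z → R x z) →
      ∀ (V : ℕ → Set W) (φ : ClmFrm), (∀ w, w ∈ satSet R V (transl (a φ))) ↔
        ∀ w, w ∈ satSet R V (φ.subst fun n => truthTable m (P n)) := by
    intro W R hR V φ
    simp only [ha _ W R hR]
    -- Truth everywhere does not distinguish χ from □⁺χ.
    exact ⟨fun h w => (h w).1, fun h w => ⟨h w, fun v _ => h v⟩⟩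
  have h1 : Rule.map a r ∈ rho M := by
    refine M.replace (M.structurality r hr fun n => truthTable m (P n)) ?_ ?_
    · intro γ hγ
      obtain ⟨φ, hφ, rfl⟩ := Finset.mem_image.1 hγ
      refine GlobalConsequence.mem_rules hK fun W R hR V hg w => ?_
      refine (htr W R hR V φ).1 (hg _ ?_) w
      exact Finset.mem_image_of_mem _ (Finset.mem_image_of_mem _ hφ)
    · intro δ hδ
      obtain ⟨φ, hφ, rfl⟩ := Finset.mem_image.1 hδ
      refine ⟨_, Finset.mem_image_of_mem _ (Finset.mem_image_of_mem _ hφ), ?_⟩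
      refine GlobalConsequence.mem_rules hK fun W R hR V hg w => ?_
      exact (htr W R hR V φ).2 (hg _ (Finset.mem_insert_self _ _)) w
  have hequiv : ∀ (W : Type) (R : W → W → Prop), (∀ x y z, R x y → R y z → R x z) →
      ∀ V : ℕ → Set W, (∀ i ∈ Θ.powerset, ∀ w, w ∈ satSet R V (grz (.neg (typeFrm Θ i)))) →
      ∀ φ ∈ r.1 ∪ r.2, (∀ w, w ∈ satSet R V φ) ↔
        ∀ w, w ∈ satSet R V ((transl (a φ)).subst e) := by
    intro W R hR V hgrz φ hφ
    rw [hrel W R hR V hgrz φ (hΘ φ hφ), ← htr W R hR, satSet_subst]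
  refine M'.replace (M'.structurality _ (h h1) e) ?_ ?_
  · intro γ hγ
    simp only [Rule.map, Finset.mem_image] at hγ
    obtain ⟨_, ⟨_, ⟨φ, hφ, rfl⟩, rfl⟩, rfl⟩ := hγ
    refine mem_rules_of_grz (A := Θ.powerset.image fun i => .neg (typeFrm Θ i)) hM'
      fun W R hR V hg w => ?_
    refine (hequiv W R hR V (fun i hi => hg _ ?_) φ (Finset.mem_union_left _ hφ)).1
      (hg _ (Finset.mem_union_left _ hφ)) w
    exact Finset.mem_union_right _ (Finset.mem_image_of_mem _ (Finset.mem_image_of_mem _ hi))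
  · intro δ hδ
    simp only [Rule.map, Finset.mem_image] at hδ
    obtain ⟨_, ⟨_, ⟨φ, hφ, rfl⟩, rfl⟩, rfl⟩ := hδ
    refine ⟨φ, hφ, ?_⟩
    refine mem_rules_of_grz (A := Θ.powerset.image fun i => .neg (typeFrm Θ i)) hM'
      fun W R hR V hg w => ?_
    refine (hequiv W R hR V (fun i hi => hg _ ?_) φ (Finset.mem_union_right _ hφ)).2
      (hg _ (Finset.mem_union_left _ (Finset.mem_insert_self _ _))) w
    exact Finset.mem_union_right _ (Finset.mem_image_of_mem _ (Finset.mem_image_of_mem _ hi))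

/-! ## General frames -/

section

variable {W : Type} {R : W → W → Prop} {H : Set (Set W)}

/-- The rules valid under all valuations in the Boolean closure of an upset algebra. -/
def IsUpsetAlgebra.ruleSystem (hH : IsUpsetAlgebra R H) : RuleSystem ClmFrm where
  rules := {r | ∀ V : ℕ → Set W, (∀ n, V n ∈ BooleanSubalgebra.closure H) →
    (∀ γ ∈ r.1, ∀ w, w ∈ satSet R V γ) → ∃ δ ∈ r.2, ∀ w, w ∈ satSet R V δ}
  structurality := by
    intro r hr s V hV h
    obtain ⟨δ, hδ, hδ'⟩ := hr (fun n => satSet R V (s n))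
      (fun n => hH.satSet_mem_closure hV (s n)) (fun γ hγ w => by
        rw [← satSet_subst]
        exact h _ (Finset.mem_image_of_mem _ hγ) w)
    refine ⟨_, Finset.mem_image_of_mem _ hδ, fun w => ?_⟩
    have := hδ' w
    rwa [← satSet_subst] at this
  reflexivity φ V _ h := ⟨φ, by simp, h φ (by simp)⟩
  monotonicity := by
    intro Γ Δ Γ' Δ' hr V hV h
    obtain ⟨δ, hδ, hδ'⟩ := hr V hV fun γ hγ => h γ (Finset.mem_union_left _ hγ)
    exact ⟨δ, Finset.mem_union_left _ hδ, hδ'⟩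
  cut := by
    intro Γ Δ φ h1 h2 V hV h
    obtain ⟨δ, hδ, hδ'⟩ := h1 V hV h
    rcases Finset.mem_insert.1 hδ with rfl | hδ
    · refine h2 V hV fun γ hγ => ?_
      rcases Finset.mem_insert.1 hγ with rfl | hγ
      · exact hδ'
      · exact h γ hγ
    · exact ⟨δ, hδ, hδ'⟩
  modusPonens := by
    intro φ ψ V _ h
    refine ⟨ψ, by simp, fun w => ?_⟩
    exact (mem_satSet_imp _ _).1 (h (φ.imp ψ) (Finset.mem_insert_of_mem
      (Finset.mem_singleton_self _)) w) (h φ (by simp) w)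
  necessitation := fun φ V _ h => ⟨_, Finset.mem_singleton_self _, fun w v _ => h φ (by simp) v⟩

/-- A Boolean combination involves only finitely many generators. -/
theorem exists_separating_of_mem_closure {A : Set W} (hA : A ∈ BooleanSubalgebra.closure H) :
    ∃ F : Finset (Set W), (∀ U ∈ F, U ∈ H) ∧
      ∀ x y, (∀ U ∈ F, x ∈ U ↔ y ∈ U) → (x ∈ A ↔ y ∈ A) := by
  classical
  induction hA using BooleanSubalgebra.closure_bot_sup_induction with
  | mem U hU => exact ⟨{U}, by simpa using hU, by simp⟩
  | bot => exact ⟨∅, by simp, by simp⟩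
  | sup A _ B _ ihA ihB =>
    obtain ⟨F, hF, hF'⟩ := ihA
    obtain ⟨E, hE, hE'⟩ := ihB
    refine ⟨F ∪ E, fun U hU => (Finset.mem_union.1 hU).elim (hF U) (hE U), fun x y h => ?_⟩
    exact or_congr (hF' x y fun U hU => h U (Finset.mem_union_left _ hU))
      (hE' x y fun U hU => h U (Finset.mem_union_right _ hU))
  | compl A _ ih =>
    obtain ⟨F, hF, hF'⟩ := ih
    exact ⟨F, hF, fun x y h => not_congr (hF' x y h)⟩

variable (hH : IsUpsetAlgebra R H)
include hH

/-- Grzegorczyk's axiom holds for Boolean combinations of upsets, because membership in such a set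
changes only finitely often along a chain. -/
theorem IsUpsetAlgebra.grz_valid {V : ℕ → Set W}
    (hV : V 0 ∈ BooleanSubalgebra.closure H) (w : W) : w ∈ satSet R V (grz (.var 0)) := by
  classical
  obtain ⟨F, hF, hsep⟩ := exists_separating_of_mem_closure hV
  simp only [grz, mem_satSet_imp, mem_satSet_box, satSet_var]
  intro h
  -- Induction on the number of sets of F not containing y; it can only drop along R, as members of
  -- F are upsets.
  have key : ∀ n, ∀ y, R w y → (F.filter fun U => y ∉ U).card = n → y ∈ V 0 := by
    intro n
    induction n using Nat.strong_induction_on with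
    | _ n ih =>
      intro y hy hn
      by_contra hyV
      -- If p fails at y, the premise of Grz makes □(p → □p) fail there. Some U in F separates y
      -- from z, so U is entered between them and u has a smaller count.
      have : ∃ z, R y z ∧ z ∈ V 0 ∧ ∃ u, R z u ∧ u ∉ V 0 := by
        by_contra! hc
        exact hyV (h y hy hc)
      obtain ⟨z, hyz, hz, u, hzu, hu⟩ := this
      refine hu (ih _ ?_ u (hH.trans _ _ _ hy (hH.trans _ _ _ hyz hzu)) rfl)
      rw [← hn]
      have hne : ∃ U ∈ F, ¬ (y ∈ U ↔ z ∈ U) := by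
        by_contra! hc
        exact hyV ((hsep y z hc).2 hz)
      obtain ⟨U, hU, hyzU⟩ := hne
      have up : ∀ U ∈ F, ∀ a b, R a b → a ∈ U → b ∈ U :=
        fun U hU a b hab ha => hH.upset U (hF U hU) a ha b hab
      refine Finset.card_lt_card ⟨?_, fun hss => ?_⟩
      · intro U hU
        simp only [Finset.mem_filter] at hU ⊢
        exact ⟨hU.1, fun hy => hU.2 (up U hU.1 _ _ hzu (up U hU.1 _ _ hyz hy))⟩
      · have hyU : y ∉ U := fun hy => hyzU (iff_of_true hy (up U hU _ _ hyz hy))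
        have hzU : z ∈ U := by tauto
        exact (Finset.mem_filter.1 (hss (Finset.mem_filter.2 ⟨hU, hyU⟩))).2 (up U hU _ _ hzu hzU)
  exact fun y hy => key _ y hy rfl

theorem IsUpsetAlgebra.K4Grz_le_ruleSystem : K4Grz ≤ hH.ruleSystem := by
  refine sup_le (RuleSystem.generate_le ?_) (RuleSystem.generate_le ?_)
  · rintro _ ⟨φ, hφ, rfl⟩ V _ _
    exact ⟨φ, Finset.mem_singleton_self _, fun w => (sat_iff_mem_satSet φ).1 (hφ W R hH.trans V w)⟩
  · rintro _ rfl V hV _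
    exact ⟨_, Finset.mem_singleton_self _, fun w => hH.grz_valid (hV 0) w⟩

end

/-! ## Theories -/

/-- A set of formulas containing an element of the conclusion of each rule of `L` whose assumptions
it contains. -/
def IsSaturated (L : RuleSystem SimFrm) (G : Set SimFrm) : Prop :=
  ∀ r ∈ L.rules, (∀ γ ∈ r.1, γ ∈ G) → ∃ δ ∈ r.2, δ ∈ G

/-- Lindenbaum's lemma for multi-conclusion rules: take G maximal such that no Γ'/Δ with finite Γ' ⊆
G is in L. If a rule of L violated saturation, each conclusion δ would, by maximality, derive Δ
together with finitely many members of G; cutting these against the rule gives a contradiction. -/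
theorem exists_isSaturated {L : RuleSystem SimFrm} {Γ Δ : Finset SimFrm}
    (h : ((Γ, Δ) : Rule SimFrm) ∉ L.rules) :
    ∃ G, IsSaturated L G ∧ (∀ γ ∈ Γ, γ ∈ G) ∧ ∀ δ ∈ Δ, δ ∉ G := by
  classical
  let F : Set (Set SimFrm) := {G | ∀ Γ' : Finset SimFrm, ↑Γ' ⊆ G →
    ((Γ', Δ) : Rule SimFrm) ∉ L.rules}
  -- Only finite premise sets are mentioned, so a maximal extension exists by Tukey's lemma.
  have hF : Order.IsOfFiniteCharacter F := by
    intro G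
    constructor
    · exact fun hG E hE _ Γ' hΓ' => hG Γ' (hΓ'.trans hE)
    · exact fun hG Γ' hΓ' => hG _ hΓ' Γ'.finite_toSet Γ' subset_rfl
  have hΓ : (Γ : Set SimFrm) ∈ F := fun Γ' hΓ' h' =>
    h (L.mono h' (by exact_mod_cast hΓ') subset_rfl)
  obtain ⟨G, hΓG, hG⟩ := hF.exists_maximal hΓ
  refine ⟨G, ?_, fun γ hγ => hΓG hγ, fun δ hδ hδG => ?_⟩
  · intro r hr hrG
    by_contra! hc
    have ex : ∀ δ ∈ r.2, ∃ E : Finset SimFrm, ↑E ⊆ G ∧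
        ((insert δ E, Δ) : Rule SimFrm) ∈ L.rules := by
      intro δ hδ
      by_contra! hE
      refine hc δ hδ (hG.le_of_ge (y := insert δ G) ?_ (Set.subset_insert _ _)
        (Set.mem_insert _ _))
      intro Γ' hΓ' h'
      refine hE (Γ'.erase δ) ?_ (L.mono h' (Finset.insert_erase_subset _ _) subset_rfl)
      intro x hx
      rw [Finset.coe_erase] at hx
      exact (hΓ' hx.1).resolve_left hx.2
    choose! E hE hE' using ex
    refine hG.prop (r.1 ∪ r.2.biUnion E) ?_ ?_
    · intro x hx
      rcases Finset.mem_union.1 (Finset.mem_coe.1 hx) with hx | hx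
      · exact hrG x hx
      · obtain ⟨δ, hδ, hx⟩ := Finset.mem_biUnion.1 hx
        exact hE δ hδ hx
    · refine L.cutAll (Γ := r.1) (Δ := r.2) hr ?_ ?_
      · exact fun γ hγ => L.mem_of_mem (Finset.mem_union_left _ hγ) (Finset.mem_insert_self _ _)
      · intro δ hδ
        refine L.mono (hE' δ hδ) (Finset.insert_subset_insert _ ?_) subset_rfl
        exact (Finset.subset_biUnion_of_mem E hδ).trans Finset.subset_union_right
  · exact hG.prop {δ} (by simpa using hδG) (L.mem_of_mem (Finset.mem_singleton_self _) hδ)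

/-- Sets of formulas containing the axioms of the modalized Heyting calculus and closed under
modus ponens and necessitation. -/
structure IsNormalTheory (G : Set SimFrm) : Prop where
  k : ∀ a b, .imp a (.imp b a) ∈ G
  s : ∀ a b c, .imp (.imp a (.imp b c)) (.imp (.imp a b) (.imp a c)) ∈ G
  andLeft : ∀ a b, .imp (.and a b) a ∈ G
  andRight : ∀ a b, .imp (.and a b) b ∈ G
  andIntro : ∀ a b, .imp a (.imp b (.and a b)) ∈ G
  orLeft : ∀ a b, .imp a (.or a b) ∈ G
  orRight : ∀ a b, .imp b (.or a b) ∈ G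
  orElim : ∀ a b c, .imp (.imp a c) (.imp (.imp b c) (.imp (.or a b) c)) ∈ G
  botElim : ∀ a, .imp .bot a ∈ G
  top : .top ∈ G
  boxImp : ∀ a b, .imp (.box (.imp a b)) (.imp (.box a) (.box b)) ∈ G
  impBox : ∀ a, .imp a (.box a) ∈ G
  boxFrontal : ∀ a b, .imp (.box a) (.or b (.imp b a)) ∈ G
  mp : ∀ a b, .imp a b ∈ G → a ∈ G → b ∈ G
  nec : ∀ a, a ∈ G → .box a ∈ G

/-- Saturation for a rule with one conclusion is closure under it; structurality provides all
instances of the axioms. -/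
theorem IsSaturated.isNormalTheory {L : RuleSystem SimFrm} (hL : mHC ≤ L) {G : Set SimFrm}
    (hG : IsSaturated L G) : IsNormalTheory G := by
  let sub : SimFrm → SimFrm → SimFrm → ℕ → SimFrm := fun a b c n =>
    match n with
    | 0 => a
    | 1 => b
    | _ => c
  have ax : ∀ φ : SimFrm, Rule.fact φ ∈ mHC.rules → ∀ a b c, φ.subst (sub a b c) ∈ G := by
    intro φ hφ a b c
    obtain ⟨δ, hδ, h⟩ := hG _ (L.structurality _ (hL hφ) (sub a b c)) (by simp [Rule.map, Rule.fact])
    obtain ⟨ψ, hψ, rfl⟩ := Finset.mem_image.1 hδ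
    rwa [Finset.mem_singleton.1 hψ] at h
  have int : ∀ φ : IntFrm, φ.Provable → ∀ a b c, φ.toSim.subst (sub a b c) ∈ G := fun φ hφ =>
    ax _ (RuleSystem.subset_generate _ (Or.inl ⟨φ, hφ, rfl⟩))
  exact
    { k := fun a b => int _ (.k (.var 0) (.var 1)) a b .bot
      s := fun a b c => int _ (.s (.var 0) (.var 1) (.var 2)) a b c
      andLeft := fun a b => int _ (.andLeft (.var 0) (.var 1)) a b .bot
      andRight := fun a b => int _ (.andRight (.var 0) (.var 1)) a b .bot
      andIntro := fun a b => int _ (.andIntro (.var 0) (.var 1)) a b .bot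
      orLeft := fun a b => int _ (.orLeft (.var 0) (.var 1)) a b .bot
      orRight := fun a b => int _ (.orRight (.var 0) (.var 1)) a b .bot
      orElim := fun a b c => int _ (.orElim (.var 0) (.var 1) (.var 2)) a b c
      botElim := fun a => int _ (.botElim (.var 0)) a .bot .bot
      top := int _ .topIntro .bot .bot .bot
      boxImp := fun a b => ax _ (RuleSystem.subset_generate _ (Or.inr (Or.inl rfl))) a b .bot
      impBox := fun a =>
        ax _ (RuleSystem.subset_generate _ (Or.inr (Or.inr (Or.inl rfl)))) a .bot .bot
      boxFrontal := fun a b =>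
        ax _ (RuleSystem.subset_generate _ (Or.inr (Or.inr (Or.inr rfl)))) a b .bot
      mp := by
        intro a b hab ha
        obtain ⟨δ, hδ, h⟩ := hG _ (L.modusPonens a b) (by
          intro γ hγ
          rcases Finset.mem_insert.1 hγ with rfl | hγ
          · exact ha
          · rw [Finset.mem_singleton.1 hγ]; exact hab)
        rwa [Finset.mem_singleton.1 hδ] at h
      nec := by
        intro a ha
        obtain ⟨δ, hδ, h⟩ := hG _ (L.necessitation a) (by simpa using ha)
        rw [Finset.mem_singleton.1 hδ] at h
        exact h }

/-- Sets of formulas above `G` closed under modus ponens. -/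
structure IsTheory (G x : Set SimFrm) : Prop where
  subset : G ⊆ x
  mp : ∀ a b, .imp a b ∈ x → a ∈ x → b ∈ x

/-- Consistent theories with the disjunction property. -/
structure IsPrimeTheory (G x : Set SimFrm) : Prop extends IsTheory G x where
  bot_notMem : .bot ∉ x
  prime : ∀ a b, .or a b ∈ x → a ∈ x ∨ b ∈ x

section

variable {G : Set SimFrm} (hG : IsNormalTheory G)
include hG

/-- The theory generated by adding one formula. -/
theorem IsNormalTheory.isTheory_adjoin {x : Set SimFrm} (hx : IsTheory G x) (a : SimFrm) :
    IsTheory G {b | .imp a b ∈ x} where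
  subset b hb := hx.mp _ _ (hx.subset (hG.k b a)) (hx.subset hb)
  mp b c hbc hb := hx.mp _ _ (hx.mp _ _ (hx.subset (hG.s a b c)) hbc) hb

theorem IsNormalTheory.subset_adjoin {x : Set SimFrm} (hx : IsTheory G x) (a : SimFrm) :
    x ⊆ {b | .imp a b ∈ x} :=
  fun b hb => hx.mp _ _ (hx.subset (hG.k b a)) hb

theorem IsNormalTheory.imp_self_mem (a : SimFrm) : .imp a a ∈ G :=
  hG.mp _ _ (hG.mp _ _ (hG.s a (.imp a a) a) (hG.k _ _)) (hG.k _ _)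

/-- A theory maximal among those omitting a is prime: for b outside it, adjoining b must yield a, so
b → a belongs to it, and ∨-elimination applies. -/
theorem IsNormalTheory.exists_isPrimeTheory {x : Set SimFrm} (hx : IsTheory G x) {a : SimFrm}
    (ha : a ∉ x) : ∃ y, x ⊆ y ∧ IsPrimeTheory G y ∧ a ∉ y := by
  obtain ⟨y, hxy, hy⟩ := zorn_subset_nonempty {y | IsTheory G y ∧ a ∉ y} (by
    intro c hc hchain hne
    refine ⟨⋃₀ c, ⟨⟨?_, ?_⟩, ?_⟩, fun s hs => Set.subset_sUnion_of_mem hs⟩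
    · obtain ⟨s, hs⟩ := hne
      exact (hc hs).1.subset.trans (Set.subset_sUnion_of_mem hs)
    · rintro b d ⟨s, hs, hbs⟩ ⟨t, ht, hbt⟩
      rcases hchain.total hs ht with h | h
      · exact ⟨t, ht, (hc ht).1.mp _ _ (h hbs) hbt⟩
      · exact ⟨s, hs, (hc hs).1.mp _ _ hbs (h hbt)⟩
    · rintro ⟨s, hs, has⟩
      exact (hc hs).2 has) x ⟨hx, ha⟩
  have hyT : IsTheory G y := hy.prop.1
  have step : ∀ b, b ∉ y → .imp b a ∈ y := by
    intro b hb
    by_contra hba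
    refine hb (hy.le_of_ge (y := {d | SimFrm.imp b d ∈ y}) ⟨hG.isTheory_adjoin hyT b, hba⟩
      (hG.subset_adjoin hyT b) ?_)
    exact hyT.subset (hG.imp_self_mem b)
  refine ⟨y, hxy, ⟨hyT, ?_, ?_⟩, hy.prop.2⟩
  · exact fun h => hy.prop.2 (hyT.mp _ _ (hyT.subset (hG.botElim a)) h)
  · intro b d hbd
    by_contra! hc
    refine hy.prop.2 (hyT.mp _ _ (hyT.mp _ _ (hyT.mp _ _ (hyT.subset (hG.orElim b d a))
      (step b hc.1)) (step d hc.2)) hbd)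

end

/-! ## The canonical frame of a normal theory -/

/-- The prime theories over `G`. -/
abbrev PrimeTheory (G : Set SimFrm) : Type := {x : Set SimFrm // IsPrimeTheory G x}

/-- The canonical accessibility relation. -/
def canonicalRel (G : Set SimFrm) (x y : PrimeTheory G) : Prop :=
  ∀ a, .box a ∈ x.1 → a ∈ y.1

/-- The prime theories that contain a given formula. -/
def extent (G : Set SimFrm) (a : SimFrm) : Set (PrimeTheory G) := {x | a ∈ x.1}

theorem extent_bot {G : Set SimFrm} : extent G .bot = ∅ :=
  Set.eq_empty_of_forall_notMem fun x hx => x.2.bot_notMem hx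

section

variable {G : Set SimFrm} (hG : IsNormalTheory G)
include hG

theorem IsNormalTheory.canonicalRel_subset {x y : PrimeTheory G} (h : canonicalRel G x y) :
    x.1 ⊆ y.1 :=
  fun a ha => h a (x.2.mp _ _ (x.2.subset (hG.impBox a)) ha)

/-- Given b in y but not in x, the axiom ⊠a → (b ∨ (b → a)) puts b → a into x for every ⊠a in x,
whence a is in y. -/
theorem IsNormalTheory.eq_or_canonicalRel {x y : PrimeTheory G} (h : x.1 ⊆ y.1) :
    y = x ∨ canonicalRel G x y := by
  by_cases hxy : y.1 ⊆ x.1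
  · exact Or.inl (Subtype.ext (Set.Subset.antisymm hxy h))
  · obtain ⟨b, hby, hbx⟩ := Set.not_subset.1 hxy
    refine Or.inr fun a ha => ?_
    have := x.2.prime _ _ (x.2.mp _ _ (x.2.subset (hG.boxFrontal a b)) ha)
    exact y.2.mp _ _ (h (this.resolve_left hbx)) hby

theorem IsNormalTheory.extent_imp (a b : SimFrm) :
    extent G (.imp a b) = boxPlusSet (canonicalRel G) ((extent G a)ᶜ ∪ extent G b) := by
  ext x
  simp only [extent, boxPlusSet, Set.mem_ofPred_eq, Set.mem_union, Set.mem_compl_iff,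
    ← imp_iff_not_or]
  constructor
  · exact fun h => ⟨x.2.mp _ _ h, fun y hy => y.2.mp _ _ (hG.canonicalRel_subset hy h)⟩
  · intro h
    by_contra hab
    -- A prime extension of x containing a but not b; it equals x or is a successor of x, and both
    -- contradict `h`.
    obtain ⟨y, hxy, hy, hby⟩ :=
      hG.exists_isPrimeTheory (hG.isTheory_adjoin x.2.toIsTheory a) hab
    have hay : a ∈ y := hxy (x.2.subset (hG.imp_self_mem a))
    rcases hG.eq_or_canonicalRel (x := x) (y := ⟨y, hy⟩)
      ((hG.subset_adjoin x.2.toIsTheory a).trans hxy) with he | hr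
    · subst he
      exact hby (h.1 hay)
    · exact hby (h.2 _ hr hay)

/-- The formulas c with ⊠c in x form a theory, and its prime extensions are exactly the successors
of x. -/
theorem IsNormalTheory.extent_box (a : SimFrm) :
    extent G (.box a) = {x | ∀ y, canonicalRel G x y → y ∈ extent G a} := by
  ext x
  constructor
  · exact fun h y hy => hy a h
  · intro h
    by_contra ha
    have hx : IsTheory G {c | .box c ∈ x.1} :=
      ⟨fun c hc => x.2.subset (hG.nec c hc),
        fun c d hcd hc => x.2.mp _ _ (x.2.mp _ _ (x.2.subset (hG.boxImp c d)) hcd) hc⟩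
    obtain ⟨y, hxy, hy, hay⟩ := hG.exists_isPrimeTheory hx ha
    exact hay (h ⟨y, hy⟩ fun c hc => hxy hc)

theorem IsNormalTheory.extent_and (a b : SimFrm) :
    extent G (.and a b) = extent G a ∩ extent G b := by
  ext x
  exact ⟨fun h => ⟨x.2.mp _ _ (x.2.subset (hG.andLeft a b)) h,
    x.2.mp _ _ (x.2.subset (hG.andRight a b)) h⟩,
    fun h => x.2.mp _ _ (x.2.mp _ _ (x.2.subset (hG.andIntro a b)) h.1) h.2⟩

theorem IsNormalTheory.extent_or (a b : SimFrm) :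
    extent G (.or a b) = extent G a ∪ extent G b := by
  ext x
  refine ⟨x.2.prime a b, ?_⟩
  rintro (h | h)
  · exact x.2.mp _ _ (x.2.subset (hG.orLeft a b)) h
  · exact x.2.mp _ _ (x.2.subset (hG.orRight a b)) h

theorem IsNormalTheory.extent_top : extent G .top = Set.univ :=
  Set.eq_univ_of_forall fun x => x.2.subset hG.top

theorem IsNormalTheory.forall_mem_extent_iff (a : SimFrm) : (∀ x, x ∈ extent G a) ↔ a ∈ G := by
  constructor
  · intro h
    by_contra ha
    obtain ⟨y, -, hy, hay⟩ := hG.exists_isPrimeTheory ⟨subset_rfl, hG.mp⟩ ha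
    exact hay (h ⟨y, hy⟩)
  · exact fun ha x => x.2.subset ha

theorem IsNormalTheory.isUpsetAlgebra :
    IsUpsetAlgebra (canonicalRel G) (Set.range (extent G)) where
  trans x y z hxy hyz a ha := hG.canonicalRel_subset hyz (hxy a ha)
  upset := by
    rintro _ ⟨a, rfl⟩ x hx y hy
    exact hG.canonicalRel_subset hy hx
  sublattice := by
    constructor
    · rintro _ ⟨a, rfl⟩ _ ⟨b, rfl⟩
      exact ⟨a.or b, hG.extent_or a b⟩
    · rintro _ ⟨a, rfl⟩ _ ⟨b, rfl⟩
      exact ⟨a.and b, hG.extent_and a b⟩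
  bot_mem := ⟨.bot, extent_bot⟩
  top_mem := ⟨.top, hG.extent_top⟩
  himp_mem := by
    rintro _ ⟨a, rfl⟩ _ ⟨b, rfl⟩
    exact ⟨a.imp b, hG.extent_imp a b⟩
  box_mem := by
    rintro _ ⟨a, rfl⟩
    exact ⟨a.box, hG.extent_box a⟩

/-- Translations see a valuation only through the interiors □⁺(V n), so V may be arbitrary apart
from these. -/
theorem IsNormalTheory.satSet_transl {V : ℕ → Set (PrimeTheory G)} {s : ℕ → SimFrm}
    (h : ∀ n, boxPlusSet (canonicalRel G) (V n) = extent G (s n)) (φ : SimFrm) :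
    satSet (canonicalRel G) V (transl φ) = extent G (φ.subst s) := by
  induction φ with
  | var n => exact h n
  | bot => exact extent_bot.symm
  | top => exact hG.extent_top.symm
  | and a b iha ihb => rw [SimFrm.subst, hG.extent_and, ← iha, ← ihb]; rfl
  | or a b iha ihb => rw [SimFrm.subst, hG.extent_or, ← iha, ← ihb, transl, satSet_or]
  | imp a b iha ihb =>
    rw [SimFrm.subst, hG.extent_imp, ← iha, ← ihb, ← satSet_neg, ← satSet_or]; rfl
  | box a iha => rw [SimFrm.subst, hG.extent_box, ← iha]; rfl

end

theorem SimFrm.subst_var (φ : SimFrm) : φ.subst .var = φ := by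
  induction φ <;> simp_all [SimFrm.subst]

/-! ## The isomorphism -/

/-- For a valuation in the Boolean closure, each interior □⁺(V n) is the extent of some formula s n.
A translated rule then says what its s-instance says about G, and L contains that instance. -/
theorem sigma_le_ruleSystem {L : RuleSystem SimFrm} {G : Set SimFrm} (hG : IsNormalTheory G)
    (hs : IsSaturated L G) : sigma L ≤ hG.isUpsetAlgebra.ruleSystem := by
  have hK := hG.isUpsetAlgebra.K4Grz_le_ruleSystem
  refine sup_le hK (sup_le (le_sup_left.trans hK) (RuleSystem.generate_le ?_))
  rintro _ ⟨r, hr, rfl⟩ V hV h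
  choose s hs' using fun n => hG.isUpsetAlgebra.boxPlusSet_mem (hV n)
  have hsat := hG.satSet_transl fun n => (hs' n).symm
  obtain ⟨δ, hδ, hδG⟩ := hs _ (L.structurality r hr s) (by
    intro γ hγ
    obtain ⟨a, ha, rfl⟩ := Finset.mem_image.1 hγ
    refine (hG.forall_mem_extent_iff _).1 fun x => ?_
    have := h _ (Finset.mem_image_of_mem _ ha) x
    rwa [hsat] at this)
  obtain ⟨a, ha, rfl⟩ := Finset.mem_image.1 hδ
  refine ⟨_, Finset.mem_image_of_mem _ ha, fun x => ?_⟩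
  rw [hsat]
  exact (hG.forall_mem_extent_iff _).2 hδG x

theorem rho_sigma {L : RuleSystem SimFrm} (hL : mHC ≤ L) : rho (sigma L) = L.rules := by
  refine Set.Subset.antisymm (fun r hr => ?_) fun r hr => ?_
  · by_contra hrL
    obtain ⟨G, hs, hΓ, hΔ⟩ := exists_isSaturated (Γ := r.1) (Δ := r.2) hrL
    have hG := hs.isNormalTheory hL
    have hsat := hG.satSet_transl (V := fun n => extent G (.var n)) (s := .var) (by
      intro n
      ext x
      exact ⟨And.left, fun hx => ⟨hx, fun y hy => hG.canonicalRel_subset hy hx⟩⟩)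
    obtain ⟨δ, hδ, h⟩ := sigma_le_ruleSystem hG hs hr (fun n => extent G (.var n))
      (fun n => BooleanSubalgebra.subset_closure ⟨_, rfl⟩) (by
        intro γ hγ x
        obtain ⟨a, ha, rfl⟩ := Finset.mem_image.1 hγ
        rw [hsat, SimFrm.subst_var]
        exact (hG.forall_mem_extent_iff _).2 (hΓ a ha) x)
    obtain ⟨a, ha, rfl⟩ := Finset.mem_image.1 hδ
    rw [hsat, SimFrm.subst_var] at h
    exact hΔ a ha ((hG.forall_mem_extent_iff _).1 h)
  · have : tau L ≤ sigma L := le_sup_right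
    exact this (le_sup_right (a := K4) (RuleSystem.subset_generate _ ⟨r, hr, rfl⟩))

theorem sigma_mono {L L' : RuleSystem SimFrm} (h : L ≤ L') : sigma L ≤ sigma L' :=
  sup_le_sup_left (sup_le_sup_left (RuleSystem.generate_le
    ((Set.image_mono h).trans (RuleSystem.subset_generate _))) _) _

theorem sigma_rhoSystem {M : RuleSystem ClmFrm} (hM : K4Grz ≤ M) :
    sigma (rhoSystem (le_sup_left.trans hM : K4 ≤ M)) = M := by
  have hK : K4 ≤ M := le_sup_left.trans hM
  refine le_antisymm (sup_le hM (sup_le hK (RuleSystem.generate_le ?_))) ?_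
  · rintro _ ⟨r, hr, rfl⟩
    exact hr
  -- By `rho_sigma`, M and σρM have the same image under ρ.
  · refine le_of_rho_subset hM le_sup_left ?_
    rw [rho_sigma (mHC_le_rhoSystem hK)]
    exact subset_rfl

/-- `σ` and `ρ` as an order isomorphism. -/
def sigmaRhoIso : NExt mHC ≃o NExt K4Grz where
  toFun L := ⟨sigma L.1, le_sup_left⟩
  invFun M := ⟨rhoSystem (le_sup_left.trans M.2), mHC_le_rhoSystem _⟩
  left_inv L := Subtype.ext (RuleSystem.ext (rho_sigma L.2))
  right_inv M := Subtype.ext (sigma_rhoSystem M.2)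
  map_rel_iff' {L L'} := by
    refine ⟨fun h => ?_, fun h => sigma_mono h⟩
    intro r hr
    rw [← rho_sigma L.2] at hr
    rw [← rho_sigma L'.2]
    exact h hr

end EsakiaThm

/-- `σ` and the restriction of `ρ` to `NExt(K4.Grz)` are mutually inverse complete lattice
isomorphisms between `NExt(mHC)` and `NExt(K4.Grz)`; in particular `ρM` is a rule system extending
`mHC` for every `M` in `NExt(K4.Grz)`. -/
theorem mainTheorem1 :
    ∃ (f : CompleteLatticeHom (EsakiaThm.NExt EsakiaThm.mHC) (EsakiaThm.NExt EsakiaThm.K4Grz))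
      (g : CompleteLatticeHom (EsakiaThm.NExt EsakiaThm.K4Grz) (EsakiaThm.NExt EsakiaThm.mHC)),
      (∀ L : EsakiaThm.NExt EsakiaThm.mHC, (f L).1 = EsakiaThm.sigma L.1) ∧
      (∀ M : EsakiaThm.NExt EsakiaThm.K4Grz, (g M).1.rules = EsakiaThm.rho M.1) ∧
      Function.LeftInverse g f ∧ Function.RightInverse g f :=
  ⟨CompleteLatticeHom.OrderIso.toCompleteLatticeHom EsakiaThm.sigmaRhoIso, 
    CompleteLatticeHom.OrderIso.toCompleteLatticeHom EsakiaThm.sigmaRhoIso.symm,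
    fun _ => rfl, fun _ => rfl, EsakiaThm.sigmaRhoIso.left_inv, EsakiaThm.sigmaRhoIso.right_inv⟩
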